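/- Let $K\in\{1,-1\}$ and let $\mathcal M_K$ be the unit sphere $S^d$ if $K=1$ and the hyperbolic space $\mathbb H^d$ of curvature $-1$ if $K=-1$, with Riemannian distance $d(\cdot,\cdot)$. Let $x_0\in\mathcal M_K$, let $R>0$, with $R<\pi/2$ if $K=1$, and let $\mathcal M=\exp_{x_0}(\bar B(0,R))$ be the closed geodesic ball of radius $R$ around $x_0$. Identify $T_{x_0}\mathcal M_K$ with $\mathbb R^d$ by an orthonormal basis, and let $h$ be the geodesic map centred at $x_0$: the gnomonic projection from the open hemisphere around $x_0$ onto $\mathbb R^d$ if $K=1$, and the Beltrami--Klein projection from $\mathbb H^d$ onto the open unit ball of $\mathbb R^d$ if $K=-1$, with $h(x_0)=0$. Let $R'>R$ and let $F$ be a real function, differentiable on the open geodesic ball of radius $R'$ around $x_0$. Assume that $F$ is $L$-smooth on $\mathcal M$ (with $L\ge 0$), i.e. for all $x,y\in\mathcal M$ $$\bigl|F(y)-F(x)-\langle\nabla F(x),\exp_x^{-1}(y)\rangle\bigr|\le \tfrac L2\, d(x,y)^2 ,$$ and that $\nabla F(x^\ast)=0$ for some $x^\ast\in\mathcal M$. (If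 $F$ is geodesically convex on $\mathcal M$, i.e. $F(y)\ge F(x)+\langle\nabla F(x),\exp_x^{-1}(y)\rangle$, only the upper bound in the displayed condition needs to be assumed.) Put $f=F\circ h^{-1}$, $\mathcal X=h(\mathcal M)$, and $c=1$ if $K=1$, $c=\cosh R$ if $K=-1$. Then $f$ is differentiable at every point of $\mathcal X$ and is $O(L)$-smooth on $\mathcal X$, with a constant that depends only on $K$ and $R$: 1. at every $\tilde x\in\mathcal X$ at which $\nabla f$ is differentiable, the spectral norm of the Hessian satisfies $\|\nabla^2 f(\tilde x)\|^2\le 44\,L^2\max\{1,R^2\}\,c^8$; 2. for all $\tilde x,\tilde y\in\mathcal X$, with $\tilde L=\sqrt{44}\,L\max\{1,R\}\,c^4$, $$\bigl|f(\tilde y)-f(\tilde x)-\langle\nabla f(\tilde x),\tilde y-\tilde x\rangle\bigr|\le \tfrac{\tilde L}{2}\,\|\tilde y-\tilde x\|^2 .$$ -/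

import Mathlib

open Topology Asymptotics

noncomputable section

/-! Space forms of curvature `K`, for `K = 1` (unit sphere) and `K = -1` (hyperbolic space, as the
upper sheet of the hyperboloid), realised in the ambient space `ℝ^d × ℝ`. -/
namespace SpaceForm

/-- The ambient vector space `ℝ^d × ℝ`. -/
abbrev Amb (d : ℕ) := EuclideanSpace ℝ (Fin d) × ℝ

variable {d : ℕ}

/-- The symmetric bilinear form `s t + K ⟪u, v⟫` of `(u, s)` and `(v, t)`. -/
def form (K : ℝ) (p q : Amb d) : ℝ := p.2 * q.2 + K * inner ℝ p.1 q.1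

/-- `K` times `form K`. For `K = 1` it is the Euclidean inner product, for `K = -1` the Lorentz form
`⟪u, v⟫ - s t`. Its restriction to tangent spaces is the Riemannian metric. -/
def metric (K : ℝ) (p q : Amb d) : ℝ := K * form K p q

/-- The unit sphere `s² + |u|² = 1` for `K = 1`; hyperbolic space `s² - |u|² = 1`, `s > 0`
for `K = -1`. -/
def space (K : ℝ) (d : ℕ) : Set (Amb d) := {p | form K p p = 1 ∧ (K = -1 → 0 < p.2)}

/-- The tangent space at `x`. -/
def tangent (K : ℝ) (x : Amb d) : Set (Amb d) := {v | form K x v = 0}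

/-- The special cosine: `cos` for `K = 1`, `cosh` for `K = -1`. -/
def cosK (K t : ℝ) : ℝ := if K = 1 then Real.cos t else Real.cosh t

/-- The special sine: `sin` for `K = 1`, `sinh` for `K = -1`. -/
def sinK (K t : ℝ) : ℝ := if K = 1 then Real.sin t else Real.sinh t

/-- The Riemannian (geodesic) distance. -/
def rdist (K : ℝ) (x y : Amb d) : ℝ :=
  if K = 1 then Real.arccos (form K x y) else Real.arcosh (form K x y)

/-- The Riemannian exponential map `exp_x v` (for `v` tangent at `x`). -/
def rexp (K : ℝ) (x v : Amb d) : Amb d :=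
  cosK K √(metric K v v) • x + (sinK K √(metric K v v) / √(metric K v v)) • v

/-- The inverse exponential map `exp_x⁻¹ y` (for `y` not antipodal to `x` when `K = 1`). -/
def rlog (K : ℝ) (x y : Amb d) : Amb d :=
  (rdist K x y / sinK K (rdist K x y)) • (y - cosK K (rdist K x y) • x)

/-- The closed geodesic ball `exp_{x₀}(B̄(0, R))`. -/
def cball (K : ℝ) (x₀ : Amb d) (R : ℝ) : Set (Amb d) := {x | x ∈ space K d ∧ rdist K x₀ x ≤ R}

/-- The open geodesic ball `exp_{x₀}(B(0, R))`. -/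
def oball (K : ℝ) (x₀ : Amb d) (R : ℝ) : Set (Amb d) := {x | x ∈ space K d ∧ rdist K x₀ x < R}

/-- `F` is differentiable at `x`, as a function on the manifold `space K d`, with Riemannian gradient
`G`: `G` is tangent at `x` and `F y = F x + ⟨G, exp_x⁻¹ y⟩ + o(d(x, y))` as `y → x` in the manifold.
Only the values of `F` on the manifold matter. -/
def HasRGradAt (K : ℝ) (F : Amb d → ℝ) (G x : Amb d) : Prop :=
  G ∈ tangent K x ∧
    (fun y => F y - F x - metric K G (rlog K x y)) =o[𝓝[space K d] x] fun y => rdist K x y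

/-- `L`-smoothness on `S` of a function `F` with gradient field `G`, in its two-sided form:
`|F y - F x - ⟨∇F x, exp_x⁻¹ y⟩| ≤ (L/2) d(x, y)²`. -/
def IsSmoothOn (K : ℝ) (S : Set (Amb d)) (F : Amb d → ℝ) (G : Amb d → Amb d) (L : ℝ) : Prop :=
  ∀ x ∈ S, ∀ y ∈ S, |F y - F x - metric K (G x) (rlog K x y)| ≤ L / 2 * rdist K x y ^ 2

/-- `e` is an orthonormal basis of the tangent space at `x₀`. -/
structure IsFrame (K : ℝ) (x₀ : Amb d) (e : Fin d → Amb d) : Prop where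
  tangent : ∀ i, e i ∈ tangent K x₀
  orthonormal : ∀ i j, metric K (e i) (e j) = if i = j then 1 else 0

/-- The geodesic map `h` centred at `x₀`, in the orthonormal coordinates of `T_{x₀}` given by `e`:
the central projection to the tangent plane at `x₀`, i.e. the gnomonic projection of the open
hemisphere around `x₀` for `K = 1`, the Beltrami-Klein projection for `K = -1`. -/
def geoMap (K : ℝ) (x₀ : Amb d) (e : Fin d → Amb d) (x : Amb d) : EuclideanSpace ℝ (Fin d) :=
  WithLp.toLp 2 fun i => metric K (e i) x / form K x₀ x

/-- The inverse `h⁻¹` of the geodesic map; it is used where `1 + K |z|² > 0`, that is on `ℝ^d` for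
`K = 1` and on the open unit ball for `K = -1`. -/
def geoMapInv (K : ℝ) (x₀ : Amb d) (e : Fin d → Amb d) (z : EuclideanSpace ℝ (Fin d)) : Amb d :=
  (√(1 + K * ‖z‖ ^ 2))⁻¹ • (x₀ + ∑ i, z i • e i)

/-! Basic checks: `geoMapInv` inverts `geoMap`, and `rlog` inverts `rexp`. -/

theorem form_comm (K : ℝ) (p q : Amb d) : form K p q = form K q p := by
  simp only [form, real_inner_comm]; ring

theorem form_add (K : ℝ) (p q r : Amb d) : form K p (q + r) = form K p q + form K p r := by
  simp only [form, Prod.fst_add, Prod.snd_add, inner_add_right]; ring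

theorem form_smul (K c : ℝ) (p q : Amb d) : form K p (c • q) = c * form K p q := by
  simp only [form, Prod.smul_fst, Prod.smul_snd, inner_smul_right, smul_eq_mul]; ring

theorem form_sum (K : ℝ) (p : Amb d) (z : Fin d → ℝ) (e : Fin d → Amb d) :
    form K p (∑ i, z i • e i) = ∑ i, z i * form K p (e i) := by
  induction (Finset.univ : Finset (Fin d)) using Finset.induction_on with
  | empty => simp [form]
  | insert a s ha ih => rw [Finset.sum_insert ha, Finset.sum_insert ha, form_add, form_smul, ih]

theorem form_center {K : ℝ} {x₀ : Amb d} {e : Fin d → Amb d} (hx₀ : x₀ ∈ space K d)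
    (he : IsFrame K x₀ e) (c : ℝ) (z : Fin d → ℝ) :
    form K x₀ (c • x₀ + ∑ i, z i • e i) = c := by
  have h : ∀ i, form K x₀ (e i) = 0 := he.tangent
  rw [form_add, form_smul, form_sum, hx₀.1]; simp [h]

theorem metric_frame {K : ℝ} {x₀ : Amb d} {e : Fin d → Amb d}
    (he : IsFrame K x₀ e) (c : ℝ) (z : Fin d → ℝ) (i : Fin d) :
    metric K (e i) (c • x₀ + ∑ j, z j • e j) = z i := by
  have h : form K x₀ (e i) = 0 := he.tangent i
  have h2 : ∀ j, K * form K (e i) (e j) = if i = j then 1 else 0 := he.orthonormal i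
  rw [metric, form_add, form_smul, form_sum, form_comm K (e i) x₀, h, mul_zero, zero_add,
    Finset.mul_sum]
  calc ∑ j, K * (z j * form K (e i) (e j)) = ∑ j, z j * (K * form K (e i) (e j)) :=
        Finset.sum_congr rfl fun j _ => by ring
    _ = z i := by simp [h2]

theorem geoMap_geoMapInv {K : ℝ} {x₀ : Amb d} {e : Fin d → Amb d} (hx₀ : x₀ ∈ space K d)
    (he : IsFrame K x₀ e) (z : EuclideanSpace ℝ (Fin d)) (hz : 0 < 1 + K * ‖z‖ ^ 2) :
    geoMap K x₀ e (geoMapInv K x₀ e z) = z := by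
  have hs : √(1 + K * ‖z‖ ^ 2) ≠ 0 := (Real.sqrt_pos.2 hz).ne'
  ext i
  have h1 := form_center hx₀ he 1 z
  have h2 := metric_frame he 1 z i
  rw [one_smul] at h1 h2
  simp only [metric] at h2
  simp only [geoMap, geoMapInv, metric, form_smul, h1, mul_left_comm K, h2]
  field_simp

theorem geoMapInv_geoMap {K : ℝ} (hK : K = 1 ∨ K = -1) {x₀ : Amb d} {e : Fin d → Amb d}
    (hx₀ : x₀ ∈ space K d) (he : IsFrame K x₀ e) (x : Amb d) (hx : x ∈ space K d)
    (hpos : 0 < form K x₀ x) : geoMapInv K x₀ e (geoMap K x₀ e x) = x := by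
  have hKK : K * K = 1 := by rcases hK with rfl | rfl <;> norm_num
  let T : (EuclideanSpace ℝ (Fin d) × ℝ) →ₗ[ℝ] Amb d :=
    { toFun := fun p => p.2 • x₀ + ∑ i, p.1 i • e i
      map_add' := fun p q => by
        simp only [Prod.snd_add, Prod.fst_add, PiLp.add_apply, add_smul, Finset.sum_add_distrib]
        abel
      map_smul' := fun c p => by
        simp only [Prod.smul_snd, Prod.smul_fst, PiLp.smul_apply, smul_eq_mul, mul_smul,
          smul_add, Finset.smul_sum, RingHom.id_apply] }
  have hinj : Function.Injective T := by
    rw [injective_iff_map_eq_zero]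
    rintro ⟨z, c⟩ h
    have h0 : c • x₀ + ∑ i, z i • e i = 0 := h
    have h1 := form_center hx₀ he c z
    rw [h0] at h1
    have hc : c = 0 := by rw [← h1]; simp [form]
    have hz : z = 0 := by
      ext i
      have h2 := metric_frame he c z i
      rw [h0] at h2
      rw [← h2]; simp [form, metric]
    simp [hc, hz]
  obtain ⟨⟨z, c⟩, hzc⟩ := (LinearMap.injective_iff_surjective.1 hinj) x
  have hx' : c • x₀ + ∑ i, z i • e i = x := hzc
  have hc : form K x₀ x = c := by rw [← hx']; exact form_center hx₀ he c z
  have hzi : ∀ i, metric K (e i) x = z i := fun i => by rw [← hx']; exact metric_frame he c z i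
  rw [hc] at hpos
  have hg : geoMap K x₀ e x = c⁻¹ • z := by
    ext i
    simp only [geoMap, hzi, hc, PiLp.smul_apply, smul_eq_mul]
    field_simp
  have hn : c ^ 2 + K * ‖z‖ ^ 2 = 1 := by
    have h1 : form K x x = 1 := hx.1
    have h2 : form K x (c • x₀ + ∑ i, z i • e i) = 1 := by rw [hx']; exact h1
    rw [form_add, form_smul, form_sum, form_comm K x x₀, hc] at h2
    have h3 : ∀ i, form K x (e i) = K * z i := fun i => by
      rw [← hzi i, metric, form_comm K x, ← mul_assoc, hKK, one_mul]
    rw [EuclideanSpace.real_norm_sq_eq, Finset.mul_sum, ← h2, pow_two]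
    congr 1
    exact Finset.sum_congr rfl fun i _ => by rw [h3]; ring
  have hs : √(1 + K * ‖c⁻¹ • z‖ ^ 2) = c⁻¹ := by
    have : 1 + K * ‖c⁻¹ • z‖ ^ 2 = (c⁻¹) ^ 2 := by
      rw [norm_smul, mul_pow, Real.norm_eq_abs, sq_abs]
      field_simp
      linarith
    rw [this, Real.sqrt_sq (inv_pos.2 hpos).le]
  rw [hg, geoMapInv, hs, inv_inv, smul_add, Finset.smul_sum]
  conv_rhs => rw [← hx']
  congr 1
  refine Finset.sum_congr rfl fun i _ => ?_
  rw [smul_smul, PiLp.smul_apply, smul_eq_mul, mul_inv_cancel_left₀ hpos.ne']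

theorem cosK_rdist {K : ℝ} (hK : K = 1 ∨ K = -1) {x y : Amb d} (hx : x ∈ space K d)
    (hy : y ∈ space K d) : cosK K (rdist K x y) = form K x y := by
  obtain ⟨hx1, hx2⟩ := hx
  obtain ⟨hy1, hy2⟩ := hy
  have hcs := abs_le.1 (abs_real_inner_le_norm x.1 y.1)
  simp only [form, real_inner_self_eq_norm_sq] at hx1 hy1
  have hnx := norm_nonneg x.1
  have hny := norm_nonneg y.1
  rcases hK with rfl | rfl
  · have hA : |x.2 * y.2| ≤ (x.2 ^ 2 + y.2 ^ 2) / 2 := by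
      rw [abs_le]; constructor <;> nlinarith [sq_nonneg (x.2 + y.2), sq_nonneg (x.2 - y.2)]
    have hA' := abs_le.1 hA
    simp only [cosK, rdist, if_true]
    rw [Real.cos_arccos]
    · simp only [form]; nlinarith [sq_nonneg (‖x.1‖ - ‖y.1‖)]
    · simp only [form]; nlinarith [sq_nonneg (‖x.1‖ - ‖y.1‖)]
  · have h0 : ¬ ((-1 : ℝ) = 1) := by norm_num
    have hx3 := hx2 rfl
    have hy3 := hy2 rfl
    have h : 1 + ‖x.1‖ * ‖y.1‖ ≤ x.2 * y.2 := by
      refine (pow_le_pow_iff_left₀ (by positivity) (by positivity) two_ne_zero).1 ?_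
      nlinarith [sq_nonneg (‖x.1‖ - ‖y.1‖)]
    simp only [cosK, rdist, if_neg h0]
    rw [Real.cosh_arcosh]
    simp only [form]; linarith

theorem rexp_rlog {K : ℝ} (hK : K = 1 ∨ K = -1) {x y : Amb d} (hx : x ∈ space K d)
    (hy : y ∈ space K d) (hpos : 0 < rdist K x y) (hlt : K = 1 → rdist K x y < Real.pi) :
    rlog K x y ∈ tangent K x ∧ metric K (rlog K x y) (rlog K x y) = rdist K x y ^ 2 ∧
      rexp K x (rlog K x y) = y := by
  have hC := cosK_rdist hK hx hy
  have hS : sinK K (rdist K x y) ≠ 0 := by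
    unfold sinK
    split_ifs with h
    · exact (Real.sin_pos_of_pos_of_lt_pi hpos (hlt h)).ne'
    · exact (Real.sinh_pos_iff.2 hpos).ne'
  have hCS : K * (1 - cosK K (rdist K x y) ^ 2) = sinK K (rdist K x y) ^ 2 := by
    rcases hK with rfl | rfl
    · simp only [cosK, sinK, if_true]
      rw [Real.sin_sq]; ring
    · have h0 : ¬ ((-1 : ℝ) = 1) := by norm_num
      simp only [cosK, sinK, if_neg h0]
      rw [Real.cosh_sq]; ring
  have hw : ∀ p : Amb d, form K p (y - cosK K (rdist K x y) • x) =
      form K p y - cosK K (rdist K x y) * form K p x := fun p => by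
    rw [sub_eq_add_neg, ← neg_smul, form_add, form_smul]; ring
  have hm : metric K (rlog K x y) (rlog K x y) = rdist K x y ^ 2 := by
    rw [metric, rlog, form_smul, form_comm, form_smul, hw, form_comm K _ x, form_comm K _ y, hw, hw,
      form_comm K y x, hx.1, hy.1, ← hC]
    field_simp
    rw [← hCS]; ring
  refine ⟨?_, hm, ?_⟩
  · change form K x (rlog K x y) = 0
    rw [rlog, form_smul, hw, hx.1, hC]; ring
  · rw [rexp, hm, Real.sqrt_sq hpos.le, rlog, smul_smul]
    rw [div_mul_div_comm, mul_comm (sinK _ _), div_self (mul_ne_zero hpos.ne' hS), one_smul]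
    abel

end SpaceForm

end

namespace SpaceForm

variable {d : ℕ}

/-! Let x = h⁻¹(z), y = h⁻¹(w), t = d(x, y), and let k be the component of ∇F(x) along the initial
unit velocity of the geodesic from x to y. Central projection turns geodesics into lines, so ⟨∇f(z),
w - z⟩ = k (B/A) sinK t with A = √(1 + K|z|²), B = √(1 + K|w|²). The Euclidean remainder of f
therefore splits as (F(y) - F(x) - t k) + k (t - (B/A) sinK t). The first term is at most L t²/2,
and t is at most a constant times |w - z|. On the line through z and w, t is an increment of
arctan(τ/a) or artanh(τ/a), and (B/A) sinK t is exactly its linear Taylor term at z, so the second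
factor of the second term is O(|w - z|²) (`rdist_geoMapInv_bounds`).

It remains to show |k| ≤ √2 · L · 2R (`IsSmoothOn.abs_metric_le`); only here does the critical point
x* enter. Follow the geodesic from x* to x. The velocity component of the gradient is L-Lipschitz:
add the smoothness inequalities for the pair and the swapped pair. For a normal component, take a
kite: two points of the geodesic at distance t before and after a midpoint m, and two points at
distance r from m in the directions ±ν. By symmetry all four sides are equal, and the four
smoothness inequalities along the sides bound the increment of the ν-component
(`IsSmoothOn.normal_step`). Small kites with r = t give the sharp rate L. Kites have to fit in the
ball, while x* may lie on its boundary. If x is interior, the depth of the geodesic grows at least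
linearly from x* (`exists_depth`): small kites fit away from x*, and thin ones with r = κt show that
the component tends to 0 at x*. Thus velocity and normal components are both at most L d(x*, x) ≤
2RL, which combine with the factor √2. A boundary point x is reached as a limit along the geodesic
towards y, whose open segment is interior.

For the Hessian, adding the Euclidean inequality for (z, w) and (w, z) bounds its quadratic form,
and for a symmetric operator this bounds the norm. -/

theorem neg_one_ne_one : ¬ ((-1 : ℝ) = 1) := by norm_num

/-! ### Special sine and cosine -/

@[simp] theorem cosK_one (t : ℝ) : cosK 1 t = Real.cos t := by simp [cosK]
@[simp] theorem sinK_one (t : ℝ) : sinK 1 t = Real.sin t := by simp [sinK]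
@[simp] theorem cosK_neg_one (t : ℝ) : cosK (-1) t = Real.cosh t := by
  simp [cosK, neg_one_ne_one]
@[simp] theorem sinK_neg_one (t : ℝ) : sinK (-1) t = Real.sinh t := by
  simp [sinK, neg_one_ne_one]

theorem cosK_sq_add {K : ℝ} (hK : K = 1 ∨ K = -1) (t : ℝ) :
    cosK K t ^ 2 + K * sinK K t ^ 2 = 1 := by
  rcases hK with rfl | rfl
  · simp [Real.cos_sq_add_sin_sq]
  · simp only [cosK_neg_one, sinK_neg_one, Real.cosh_sq]; ring

theorem cosK_sub {K : ℝ} (hK : K = 1 ∨ K = -1) (s t : ℝ) :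
    cosK K (s - t) = cosK K s * cosK K t + K * (sinK K s * sinK K t) := by
  rcases hK with rfl | rfl
  · simp [Real.cos_sub]
  · simp only [cosK_neg_one, sinK_neg_one, Real.cosh_sub]; ring

theorem sinK_sub {K : ℝ} (hK : K = 1 ∨ K = -1) (s t : ℝ) :
    sinK K (s - t) = sinK K s * cosK K t - cosK K s * sinK K t := by
  rcases hK with rfl | rfl
  · simp [Real.sin_sub]
  · simp only [cosK_neg_one, sinK_neg_one, Real.sinh_sub]

@[simp] theorem cosK_neg {K : ℝ} (t : ℝ) : cosK K (-t) = cosK K t := by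
  simp [cosK]

@[simp] theorem sinK_neg {K : ℝ} (t : ℝ) : sinK K (-t) = - sinK K t := by
  unfold sinK; split_ifs <;> simp

@[simp] theorem cosK_zero {K : ℝ} : cosK K 0 = 1 := by simp [cosK]

@[simp] theorem sinK_zero {K : ℝ} : sinK K 0 = 0 := by simp [sinK]

theorem sinK_pos {K : ℝ} {t : ℝ} (ht : 0 < t) (htK : K = 1 → t < Real.pi) : 0 < sinK K t := by
  unfold sinK
  split_ifs with h
  · exact Real.sin_pos_of_pos_of_lt_pi ht (htK h)
  · exact Real.sinh_pos_iff.2 ht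

theorem mul_self_eq_one {K : ℝ} (hK : K = 1 ∨ K = -1) : K * K = 1 := by
  rcases hK with rfl | rfl <;> norm_num

/-! ### The bilinear form and unit speed geodesics -/

theorem form_add_left (K : ℝ) (p q r : Amb d) : form K (q + r) p = form K q p + form K r p := by
  rw [form_comm, form_add, form_comm K p, form_comm K p]

theorem form_smul_left (K c : ℝ) (p q : Amb d) : form K (c • q) p = c * form K q p := by
  rw [form_comm, form_smul, form_comm K p]

theorem form_neg (K : ℝ) (p q : Amb d) : form K p (-q) = - form K p q := by
  rw [← neg_one_smul ℝ, form_smul]; ring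

theorem form_sub (K : ℝ) (p q r : Amb d) : form K p (q - r) = form K p q - form K p r := by
  rw [sub_eq_add_neg, form_add, form_neg]; ring

theorem form_sub_left (K : ℝ) (p q r : Amb d) : form K (q - r) p = form K q p - form K r p := by
  rw [form_comm, form_sub, form_comm K p, form_comm K p]

/-- The unit speed geodesic with initial point `p` and initial velocity `v`. -/
noncomputable def geo (K : ℝ) (p v : Amb d) (s : ℝ) : Amb d := cosK K s • p + sinK K s • v

theorem form_geo (K : ℝ) (w p v : Amb d) (s : ℝ) :
    form K w (geo K p v s) = cosK K s * form K w p + sinK K s * form K w v := by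
  rw [geo, form_add, form_smul, form_smul]

/-- `v` is a unit tangent vector at `p`. -/
structure IsUnitTangent (K : ℝ) (p v : Amb d) : Prop where
  tangent : form K p v = 0
  unit : form K v v = K

theorem form_geo_geo {K : ℝ} (hK : K = 1 ∨ K = -1) {p v : Amb d} (hp : p ∈ space K d)
    (hv : IsUnitTangent K p v) (s t : ℝ) :
    form K (geo K p v s) (geo K p v t) = cosK K (s - t) := by
  rw [form_geo, form_comm K _ p, form_comm K _ v, form_geo, form_geo, hp.1, form_comm K v p,
    hv.tangent, hv.unit, cosK_sub hK]
  ring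

/-- Reversed Cauchy-Schwarz for K = -1: two timelike vectors on opposite sheets have negative form,
so positivity of the form with p selects the upper sheet. -/
theorem mem_space_of_form {K : ℝ} {p y : Amb d} (hp : p ∈ space K d) (hy : form K y y = 1)
    (hpos : K = -1 → 0 < form K p y) : y ∈ space K d := by
  refine ⟨hy, fun h => ?_⟩
  subst h
  have hp2 := hp.2 rfl
  have h1 := hp.1
  have h3 := hpos rfl
  simp only [form, real_inner_self_eq_norm_sq] at h1 hy h3
  by_contra hneg
  push Not at hneg
  have hcs := abs_le.1 (abs_real_inner_le_norm p.1 y.1)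
  have hA : ‖p.1‖ ≤ p.2 := abs_le_of_sq_le_sq' (by nlinarith) hp2.le |>.2
  have hB : ‖y.1‖ ≤ -y.2 := abs_le_of_sq_le_sq' (by nlinarith) (by linarith) |>.2
  nlinarith [mul_le_mul hA hB (norm_nonneg _) hp2.le]

theorem one_le_form {x y : Amb d} (hx : x ∈ space (-1) d) (hy : y ∈ space (-1) d) :
    1 ≤ form (-1) x y := by
  rw [← cosK_rdist (Or.inr rfl) hx hy, cosK_neg_one]
  exact Real.one_le_cosh _

theorem geo_mem_space {K : ℝ} (hK : K = 1 ∨ K = -1) {p v : Amb d} (hp : p ∈ space K d)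
    (hv : IsUnitTangent K p v) (s : ℝ) : geo K p v s ∈ space K d := by
  refine mem_space_of_form hp ?_ ?_
  · rw [form_geo_geo hK hp hv]; simp
  · rintro rfl
    rw [form_geo, hp.1, hv.tangent]
    simp [Real.cosh_pos]

/-! ### Distance and balls -/

theorem rdist_nonneg {K : ℝ} (hK : K = 1 ∨ K = -1) {x y : Amb d} (hx : x ∈ space K d)
    (hy : y ∈ space K d) : 0 ≤ rdist K x y := by
  rcases hK with rfl | rfl
  · simp [rdist, Real.arccos_nonneg]
  · simp only [rdist, if_neg neg_one_ne_one]
    exact Real.arcosh_nonneg (one_le_form hx hy)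

theorem rdist_le_pi {x y : Amb d} : rdist 1 x y ≤ Real.pi := by
  simp [rdist, Real.arccos_le_pi]

theorem rdist_comm (K : ℝ) (x y : Amb d) : rdist K x y = rdist K y x := by
  simp only [rdist, form_comm K x y]

theorem rdist_eq_of_form {K : ℝ} {x y : Amb d} {t : ℝ} (ht : 0 ≤ t)
    (htK : K = 1 → t ≤ Real.pi) (h : form K x y = cosK K t) : rdist K x y = t := by
  unfold rdist
  split_ifs with h1
  · rw [h, h1, cosK_one, Real.arccos_cos ht (htK h1)]
  · rw [h, cosK, if_neg h1, Real.arcosh_cosh ht]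

theorem rdist_congr {K : ℝ} {x y x' y' : Amb d} (h : form K x y = form K x' y') :
    rdist K x y = rdist K x' y' := by
  simp only [rdist, h]

/-- The factor K compensates for cos decreasing and cosh increasing, so that both curvatures share
one criterion. -/
theorem cosK_le_cosK_iff {K : ℝ} (hK : K = 1 ∨ K = -1) {s t : ℝ} (hs : 0 ≤ s) (ht : 0 ≤ t)
    (hsK : K = 1 → s ≤ Real.pi) (htK : K = 1 → t ≤ Real.pi) :
    0 ≤ K * (cosK K s - cosK K t) ↔ s ≤ t := by
  rcases hK with rfl | rfl
  · simp only [cosK_one, one_mul, sub_nonneg]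
    exact Real.strictAntiOn_cos.le_iff_ge ⟨ht, htK rfl⟩ ⟨hs, hsK rfl⟩
  · simp only [cosK_neg_one, neg_mul, one_mul, neg_sub, sub_nonneg]
    rw [Real.cosh_le_cosh, abs_of_nonneg hs, abs_of_nonneg ht]

/-- A ball is the part of the space cut out by a half-space of the ambient space. The quantity on
the right serves below as the depth of y in the ball. -/
theorem mem_cball_iff {K : ℝ} (hK : K = 1 ∨ K = -1) {x₀ : Amb d} (hx₀ : x₀ ∈ space K d)
    {R : ℝ} (hR : 0 ≤ R) (hRK : K = 1 → R ≤ Real.pi) {y : Amb d} (hy : y ∈ space K d) :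
    y ∈ cball K x₀ R ↔ 0 ≤ K * (form K x₀ y - cosK K R) := by
  rw [← cosK_rdist hK hx₀ hy, cosK_le_cosK_iff hK (rdist_nonneg hK hx₀ hy) hR _ hRK]
  · simp [cball, hy]
  · rintro rfl; exact rdist_le_pi

/-- Two distinct non-antipodal points are joined by a unit speed geodesic. -/
theorem exists_geo {K : ℝ} (hK : K = 1 ∨ K = -1) {x y : Amb d} (hx : x ∈ space K d)
    (hy : y ∈ space K d) (hpos : 0 < rdist K x y) (hlt : K = 1 → rdist K x y < Real.pi) :
    ∃ v, IsUnitTangent K x v ∧ geo K x v (rdist K x y) = y := by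
  obtain ⟨h1, h2, h3⟩ := rexp_rlog hK hx hy hpos hlt
  refine ⟨(rdist K x y)⁻¹ • rlog K x y, ⟨?_, ?_⟩, ?_⟩
  · rw [form_smul]
    have : form K x (rlog K x y) = 0 := h1
    rw [this, mul_zero]
  · rw [form_smul, form_smul_left]
    have h4 : K * form K (rlog K x y) (rlog K x y) = rdist K x y ^ 2 := h2
    have h5 : form K (rlog K x y) (rlog K x y) = K * rdist K x y ^ 2 := by
      rw [← h4, ← mul_assoc, mul_self_eq_one hK, one_mul]
    rw [h5]; field_simp
  · rw [rexp, h2, Real.sqrt_sq hpos.le] at h3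
    rw [geo, smul_smul, ← div_eq_mul_inv, h3]

/-! ### First consequences of smoothness for the gradient -/

theorem metric_rlog {K : ℝ} {x g y : Amb d} (hg : form K x g = 0) :
    metric K g (rlog K x y) = rdist K x y / sinK K (rdist K x y) * metric K g y := by
  rw [metric, metric, rlog, form_smul, form_sub, form_smul, form_comm K g x, hg]; ring

/-- Variation of the gradient between `p` and `q`, tested on two points equidistant from both. -/
theorem IsSmoothOn.metric_sub_le {K : ℝ} {S : Set (Amb d)} {F : Amb d → ℝ}
    {G : Amb d → Amb d} {L : ℝ} (hF : IsSmoothOn K S F G L) (hG : ∀ x ∈ S, form K x (G x) = 0)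
    {p q y z : Amb d} (hp : p ∈ S) (hq : q ∈ S) (hy : y ∈ S) (hz : z ∈ S) {r : ℝ} (hr : 0 < r)
    (hs : 0 < sinK K r) (hpy : rdist K p y = r) (hpz : rdist K p z = r) (hqy : rdist K q y = r)
    (hqz : rdist K q z = r) :
    metric K (G q) (y - z) - metric K (G p) (y - z) ≤ 2 * L * r * sinK K r := by
  have h1 := hF q hq y hy
  have h2 := hF p hp y hy
  have h3 := hF q hq z hz
  have h4 := hF p hp z hz
  rw [metric_rlog (hG q hq), hqy, abs_le] at h1
  rw [metric_rlog (hG p hp), hpy, abs_le] at h2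
  rw [metric_rlog (hG q hq), hqz, abs_le] at h3
  rw [metric_rlog (hG p hp), hpz, abs_le] at h4
  -- Each of F y and F z is estimated from p and from q; in the signed sum of the four inequalities
  -- all values of F cancel, leaving four errors L r²/2.
  have h5 : r / sinK K r * (metric K (G q) (y - z) - metric K (G p) (y - z)) ≤ 2 * L * r ^ 2 := by
    simp only [metric, form_sub] at h1 h2 h3 h4 ⊢
    linarith [h1.2, h2.1, h3.1, h4.2, h1.1, h2.2, h3.2, h4.1]
  have h6 := mul_le_mul_of_nonneg_left h5 (div_pos hs hr).le
  calc _ = sinK K r / r * (r / sinK K r * (metric K (G q) (y - z) - metric K (G p) (y - z))) := by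
        field_simp
    _ ≤ _ := h6
    _ = _ := by field_simp

/-- Along a geodesic the velocity component of the gradient is Lipschitz. -/
theorem IsSmoothOn.abs_metric_geo_sub_le {K : ℝ} (hK : K = 1 ∨ K = -1) {S : Set (Amb d)}
    {F : Amb d → ℝ}
    {G : Amb d → Amb d} {L : ℝ} (hF : IsSmoothOn K S F G L) (hG : ∀ x ∈ S, form K x (G x) = 0)
    {p v : Amb d} (hps : p ∈ space K d) (hv : IsUnitTangent K p v) {s : ℝ} (hs : 0 < s)
    (hsK : K = 1 → s < Real.pi) (hp : p ∈ S) (hq : geo K p v s ∈ S) :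
    |metric K (G (geo K p v s)) (cosK K s • v - (K * sinK K s) • p) - metric K (G p) v|
      ≤ L * s := by
  set q := geo K p v s with hqd
  have hsin := sinK_pos hs hsK
  have hpq : rdist K p q = s := by
    refine rdist_eq_of_form hs.le (fun h => (hsK h).le) ?_
    rw [hqd, form_geo, hps.1, hv.tangent]; ring
  have h1 := hF p hp q hq
  have h2 := hF q hq p hp
  rw [metric_rlog (hG p hp), hpq, abs_le] at h1
  rw [metric_rlog (hG q hq), rdist_comm, hpq, abs_le] at h2
  have hG1 : metric K (G p) q = sinK K s * metric K (G p) v := by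
    rw [metric, hqd, form_geo, form_comm K _ p, hG p hp, metric]; ring
  have h0 : cosK K s * form K (G q) p + sinK K s * form K (G q) v = 0 := by
    rw [← form_geo, form_comm]; exact hG q hq
  -- Seen from q, the point p lies in the direction opposite to the terminal velocity; tangency of G
  -- q removes the component along q.
  have hG2 : metric K (G q) p
      = - (sinK K s * metric K (G q) (cosK K s • v - (K * sinK K s) • p)) := by
    have h3 := cosK_sq_add hK s
    simp only [metric, form_sub, form_smul]
    linear_combination (K * cosK K s) * h0 - (K * form K (G q) p) * h3
  rw [hG1] at h1
  rw [hG2] at h2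
  have e1 : ∀ m, s / sinK K s * (sinK K s * m) = s * m := fun m => by field_simp
  rw [mul_neg, e1] at h2
  rw [e1] at h1
  rw [abs_le]
  constructor <;> refine le_of_mul_le_mul_left ?_ hs <;> nlinarith [h1.1, h1.2, h2.1, h2.2]

/-! ### Convexity of balls and depth along geodesics -/

/-- Sum-to-product: the expression equals 4 sinK(s/2) sinK((D - s)/2) sinK(D/2). -/
theorem mul_sinK_sub_pos {K : ℝ} (hK : K = 1 ∨ K = -1) {s D : ℝ} (hs : 0 < s) (hsD : s < D)
    (hDK : K = 1 → D < Real.pi) : 0 < K * (sinK K (D - s) + sinK K s - sinK K D) := by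
  obtain ⟨a, rfl⟩ : ∃ a, s = 2 * a := ⟨s / 2, by ring⟩
  obtain ⟨b, rfl⟩ : ∃ b, D = 2 * a + 2 * b := ⟨(D - 2 * a) / 2, by ring⟩
  have ha : 0 < a := by linarith
  have hb : 0 < b := by linarith
  have hsub : 2 * a + 2 * b - 2 * a = 2 * b := by ring
  rw [hsub]
  have h1 : 0 < sinK K a := sinK_pos ha fun h => by linarith [hDK h, Real.pi_pos]
  have h2 : 0 < sinK K b := sinK_pos hb fun h => by linarith [hDK h, Real.pi_pos]
  have h3 : 0 < sinK K (a + b) := sinK_pos (by linarith) fun h => by linarith [hDK h, Real.pi_pos]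
  have key : K * (sinK K (2 * b) + sinK K (2 * a) - sinK K (2 * a + 2 * b))
      = 4 * (sinK K a * sinK K b * sinK K (a + b)) := by
    have e : 2 * a + 2 * b = 2 * (a + b) := by ring
    rw [e]
    rcases hK with rfl | rfl
    · simp only [sinK_one, Real.sin_two_mul, Real.sin_add, Real.cos_add]
      linear_combination
        (-2 * Real.sin b * Real.cos b) * Real.sin_sq_add_cos_sq a +
        (-2 * Real.sin a * Real.cos a) * Real.sin_sq_add_cos_sq b
    · simp only [sinK_neg_one, Real.sinh_two_mul, Real.sinh_add, Real.cosh_add]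
      linear_combination
        (2 * Real.sinh b * Real.cosh b) * Real.cosh_sq a +
        (2 * Real.sinh a * Real.cosh a) * Real.cosh_sq b
  rw [key]; positivity

/-- A linear functional along a geodesic solves u'' = -K u, so it is the sinK-interpolation of its
end values. Subtracting the constant c leaves a defect term, which is positive inside the segment
when c > 0; with c = cosK R this is where R < π/2 matters. -/
theorem sinK_mul_geo {K : ℝ} (hK : K = 1 ∨ K = -1) (a b c s D : ℝ) :
    sinK K D * (K * (cosK K s * a + sinK K s * b - c)) =
      sinK K (D - s) * (K * (a - c)) + sinK K s * (K * (cosK K D * a + sinK K D * b - c)) +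
        c * (K * (sinK K (D - s) + sinK K s - sinK K D)) := by
  rw [sinK_sub hK]; ring

/-- Strict convexity of balls: the open segment is interior. -/
theorem interior_of_geo {K : ℝ} (hK : K = 1 ∨ K = -1) {a b c s D : ℝ} (hc : 0 < c)
    (h0 : 0 ≤ K * (a - c)) (hD : 0 ≤ K * (cosK K D * a + sinK K D * b - c))
    (hs : 0 < s) (hsD : s < D) (hDK : K = 1 → D < Real.pi) :
    0 < K * (cosK K s * a + sinK K s * b - c) := by
  have h1 := mul_sinK_sub_pos hK hs hsD hDK
  have h2 : 0 < sinK K D := sinK_pos (by linarith) hDK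
  have h3 : 0 < sinK K s := sinK_pos hs fun h => by linarith [hDK h]
  have h4 : 0 < sinK K (D - s) := sinK_pos (by linarith) fun h => by linarith [hDK h]
  refine pos_of_mul_pos_right ?_ h2.le
  rw [sinK_mul_geo hK]
  positivity

theorem exists_mul_le_sinK {K : ℝ} (hK : K = 1 ∨ K = -1) {D : ℝ} (hD : 0 < D)
    (hDK : K = 1 → D < Real.pi) : ∃ κ > 0, ∀ s, 0 ≤ s → s ≤ D → κ * s ≤ sinK K s := by
  rcases hK with rfl | rfl
  · have hpi := hDK rfl
    have hsD := Real.sin_pos_of_pos_of_lt_pi hD hpi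
    refine ⟨Real.sin D / D, by positivity, fun s hs hs' => ?_⟩
    have h1 : 0 ≤ 1 - s / D := by rw [sub_nonneg, div_le_one hD]; exact hs'
    have h2 : 0 ≤ s / D := by positivity
    have := strictConcaveOn_sin_Icc.concaveOn.2 ⟨le_rfl, Real.pi_pos.le⟩ ⟨hD.le, hpi.le⟩ h1 h2
      (by ring)
    simp only [Real.sin_zero, smul_eq_mul, mul_zero, zero_add, div_mul_cancel₀ _ hD.ne'] at this
    rw [sinK_one]
    calc _ = s / D * Real.sin D := by ring
      _ ≤ _ := this
  · refine ⟨1, one_pos, fun s hs _ => ?_⟩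
    rw [sinK_neg_one, one_mul]
    exact Real.self_le_sinh_iff.2 hs

/-- The depth of a geodesic that ends in the interior of a ball grows at least linearly. -/
theorem exists_depth {K : ℝ} (hK : K = 1 ∨ K = -1) {a b c D : ℝ} (hc : 0 < c)
    (h0 : 0 ≤ K * (a - c)) (hD' : 0 < K * (cosK K D * a + sinK K D * b - c))
    (hD : 0 < D) (hDK : K = 1 → D < Real.pi) :
    ∃ κ > 0, ∀ s, 0 ≤ s → s ≤ D → κ * s ≤ K * (cosK K s * a + sinK K s * b - c) := by
  have h2 : 0 < sinK K D := sinK_pos hD hDK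
  obtain ⟨κ, hκ, hs⟩ := exists_mul_le_sinK hK hD hDK
  set δ := K * (cosK K D * a + sinK K D * b - c) with hδ
  refine ⟨κ * δ / sinK K D, by positivity, fun s hs0 hsD => ?_⟩
  have h1 : 0 ≤ K * (sinK K (D - s) + sinK K s - sinK K D) := by
    rcases hs0.eq_or_lt with rfl | h
    · simp
    rcases hsD.eq_or_lt with rfl | h'
    · simp
    exact (mul_sinK_sub_pos hK h h' hDK).le
  have h4 : 0 ≤ sinK K (D - s) := by
    rcases hsD.eq_or_lt with rfl | h
    · simp
    exact (sinK_pos (by linarith) fun h => by linarith [hDK h]).le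
  rw [div_mul_eq_mul_div, div_le_iff₀ h2, mul_comm _ (sinK K D), sinK_mul_geo hK, ← hδ]
  have h5 := mul_le_mul_of_nonneg_right (hs s hs0 hsD) hD'.le
  have h6 := mul_nonneg h4 h0
  have h7 := mul_nonneg hc.le h1
  linarith

/-! ### Estimates at small radii -/

theorem abs_cosK_sub_one_le {K : ℝ} (hK : K = 1 ∨ K = -1) {r : ℝ} (h0 : 0 ≤ r) (h1 : r ≤ 1) :
    |cosK K r - 1| ≤ r := by
  rcases hK with rfl | rfl
  · rw [cosK_one, abs_le]
    constructor <;> nlinarith [Real.one_sub_sq_div_two_le_cos (x := r), Real.cos_le_one r]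
  · rw [cosK_neg_one, abs_of_nonneg (by linarith [Real.one_le_cosh r])]
    have h2 := Real.cosh_le_exp_half_sq r
    have h3 : |r ^ 2 / 2| ≤ 1 := by rw [abs_of_nonneg (by positivity)]; nlinarith
    have h4 := Real.abs_exp_sub_one_sub_id_le h3
    have h5 := (abs_le.1 h4).2
    have h6 : r ^ 2 ≤ r := by nlinarith
    nlinarith [mul_le_mul h6 h6 (by positivity) h0]

theorem abs_sinK_le {K : ℝ} (hK : K = 1 ∨ K = -1) {r : ℝ} (h0 : 0 ≤ r) (h1 : r ≤ 1) :
    |sinK K r| ≤ 2 * r := by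
  have h := cosK_sq_add hK r
  have h2 := abs_le.1 (abs_cosK_sub_one_le hK h0 h1)
  rcases hK with rfl | rfl
  · rw [sinK_one]
    have := Real.abs_sin_le_abs (x := r)
    rw [abs_of_nonneg h0] at this
    linarith
  · rw [sinK_neg_one, Real.abs_sinh, Real.sinh_eq, abs_of_nonneg h0]
    have h3 : |r| ≤ 1 := by rw [abs_of_nonneg h0]; exact h1
    have h4 := (abs_le.1 (Real.abs_exp_sub_one_sub_id_le h3)).2
    have h5 := Real.add_one_le_exp (-r)
    nlinarith

/-- Telescoping over N equal pieces shorter than η; n need not be continuous. -/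
theorem sub_le_of_locally_sub_le {n : ℝ → ℝ} {a b C η : ℝ} (hab : a ≤ b) (hη : 0 < η)
    (h : ∀ s₁ s₂, a ≤ s₁ → s₁ < s₂ → s₂ ≤ b → s₂ - s₁ ≤ η → n s₂ - n s₁ ≤ C * (s₂ - s₁)) :
    n b - n a ≤ C * (b - a) := by
  rcases hab.eq_or_lt with rfl | hlt
  · simp
  obtain ⟨N, hN⟩ := exists_nat_gt ((b - a) / η)
  have hN0 : (0 : ℝ) < N := lt_of_le_of_lt (div_nonneg (sub_nonneg.2 hab) hη.le) hN
  set w := (b - a) / N with hw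
  have hw0 : 0 < w := div_pos (by linarith) hN0
  have hwη : w ≤ η := by
    rw [div_lt_iff₀ hη] at hN
    rw [hw, div_le_iff₀ hN0]; linarith
  have hNw : N * w = b - a := by rw [hw]; field_simp
  have key : ∀ k : ℕ, k ≤ N → n (a + k * w) - n a ≤ C * (k * w) := by
    intro k
    induction k with
    | zero => simp
    | succ k ih =>
      intro hk
      have hk' : ((k : ℝ) + 1) ≤ N := by exact_mod_cast hk
      have h1 := ih (by omega)
      have h2 := h (a + k * w) (a + (k + 1) * w) (by nlinarith [mul_nonneg (Nat.cast_nonneg (α := ℝ) k) hw0.le]) (by linarith)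
        (by nlinarith) (by linarith)
      push_cast
      linarith
  have := key N le_rfl
  rwa [hNw, add_sub_cancel] at this

theorem abs_form_le_cosh {K : ℝ} (hK : K = 1 ∨ K = -1) {x₀ : Amb d} (hx₀ : x₀ ∈ space K d)
    {R : ℝ} {y : Amb d} (hy : y ∈ cball K x₀ R) : |form K x₀ y| ≤ Real.cosh R := by
  have h0 := rdist_nonneg hK hx₀ hy.1
  rw [← cosK_rdist hK hx₀ hy.1]
  rcases hK with rfl | rfl
  · rw [cosK_one]
    exact (Real.abs_cos_le_one _).trans (Real.one_le_cosh R)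
  · rw [cosK_neg_one, abs_of_pos (Real.cosh_pos _), Real.cosh_le_cosh, abs_of_nonneg h0,
      abs_of_nonneg (h0.trans hy.2)]
    exact hy.2

/-- Trades ρ sinK ρ for sinK² ρ, which is algebraic in the form, at the price of θ. For K = 1 this
is ρ cos ρ ≤ sin ρ, for K = -1 it is ρ ≤ sinh ρ. -/
theorem rdist_mul_sinK_le {K : ℝ} (hK : K = 1 ∨ K = -1) {x y : Amb d} (hx : x ∈ space K d)
    (hy : y ∈ space K d) {θ : ℝ} (hθ : θ ≤ 1) (hpos : 0 < form K x y)
    (hθK : K = 1 → θ ≤ form K x y) :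
    θ * (rdist K x y * sinK K (rdist K x y)) ≤ K * (1 - form K x y ^ 2) := by
  have h0 := rdist_nonneg hK hx hy
  rw [← cosK_rdist hK hx hy] at hpos hθK ⊢
  set ρ := rdist K x y with hρ
  have h1 := cosK_sq_add hK ρ
  have h2 : K * (1 - cosK K ρ ^ 2) = sinK K ρ ^ 2 := by
    linear_combination sinK K ρ ^ 2 * mul_self_eq_one hK - K * h1
  rw [h2]
  suffices h : θ * ρ ≤ sinK K ρ ∧ 0 ≤ sinK K ρ by nlinarith [mul_le_mul_of_nonneg_right h.1 h.2]
  rcases hK with rfl | rfl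
  · simp only [cosK_one, sinK_one] at *
    have hpi : ρ ≤ Real.pi := rdist_le_pi
    have hlt : ρ < Real.pi / 2 := by
      by_contra hcon
      push Not at hcon
      exact absurd hpos (not_lt.2 (Real.cos_nonpos_of_pi_div_two_le_of_le hcon (by linarith)))
    refine ⟨?_, Real.sin_nonneg_of_nonneg_of_le_pi h0 hpi⟩
    have h3 := Real.le_tan h0 hlt
    rw [Real.tan_eq_sin_div_cos, le_div_iff₀ hpos] at h3
    nlinarith [hθK trivial]
  · simp only [sinK_neg_one]
    have h3 := Real.self_le_sinh_iff.2 h0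
    exact ⟨by nlinarith, by linarith⟩

/-! ### Normal components of the gradient: the kite argument -/

/-- Difference of a normal component of the gradient along a geodesic. -/
theorem IsSmoothOn.normal_step {K : ℝ} (hK : K = 1 ∨ K = -1) {S : Set (Amb d)}
    (hS : S ⊆ space K d) {F : Amb d → ℝ} {G : Amb d → Amb d} {L : ℝ} (hL : 0 ≤ L)
    (hF : IsSmoothOn K S F G L)
    (hG : ∀ x ∈ S, form K x (G x) = 0) {p v ν : Amb d} (hp : p ∈ space K d)
    (hv : IsUnitTangent K p v) (hpν : form K p ν = 0) (hvν : form K v ν = 0)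
    {s t r : ℝ} (ht0 : 0 < t) (ht1 : t ≤ 1) (hr0 : 0 < r) (hr1 : r ≤ 1)
    (h1 : geo K p v (s - t) ∈ S) (h2 : geo K p v (s + t) ∈ S)
    (h3 : cosK K r • geo K p v s + sinK K r • ν ∈ S)
    (h4 : cosK K r • geo K p v s - sinK K r • ν ∈ S) :
    Real.cos t * Real.cos r *
      (sinK K r * (metric K (G (geo K p v (s + t))) ν - metric K (G (geo K p v (s - t))) ν)) ≤
      L * (K * (1 - (cosK K t * cosK K r) ^ 2)) := by
  set y := cosK K r • geo K p v s + sinK K r • ν with hy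
  set z := cosK K r • geo K p v s - sinK K r • ν with hz
  have hn : ∀ u, form K (geo K p v u) ν = 0 := fun u => by
    rw [form_comm, form_geo, form_comm K ν, hpν, form_comm K ν, hvν]; ring
  -- Pythagoras in the space form: the cosine of the hypotenuse is the product of the cosines of the
  -- legs. It is even in u - s and in the sign of ν, so the four sides agree.
  have hfy : ∀ u, form K (geo K p v u) y = cosK K (u - s) * cosK K r := fun u => by
    rw [hy, form_add, form_smul, form_smul, hn, form_geo_geo hK hp hv]; ring
  have hfz : ∀ u, form K (geo K p v u) z = cosK K (u - s) * cosK K r := fun u => by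
    rw [hz, form_sub, form_smul, form_smul, hn, form_geo_geo hK hp hv]; ring
  have e1 : s - t - s = -t := by ring
  have e2 : s + t - s = t := by ring
  have hqy := hfy (s + t)
  have hqz := hfz (s + t)
  have hpy := hfy (s - t)
  have hpz := hfz (s - t)
  rw [e2] at hqy hqz
  rw [e1, cosK_neg] at hpy hpz
  have hπ := Real.pi_gt_three
  have hct : 0 < Real.cos t := Real.cos_pos_of_mem_Ioo ⟨by linarith, by linarith⟩
  have hcr : 0 < Real.cos r := Real.cos_pos_of_mem_Ioo ⟨by linarith, by linarith⟩
  have hct1 : Real.cos t < 1 := by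
    have := Real.cos_lt_cos_of_nonneg_of_le_pi_div_two le_rfl (by linarith) ht0
    simpa using this
  have hcr1 := Real.cos_le_one r
  have hpos : 0 < form K (geo K p v (s - t)) y := by
    rw [hpy]
    rcases hK with rfl | rfl
    · simp only [cosK_one]; positivity
    · simp only [cosK_neg_one]; positivity
  -- θ = cos t cos r serves both curvatures: for K = 1 it equals cos ρ, for K = -1 only θ ≤ 1 is
  -- needed.
  have hθ : Real.cos t * Real.cos r ≤ 1 := by nlinarith
  have hmain := rdist_mul_sinK_le hK (hS h1) (hS h3) hθ hpos (by
    rintro rfl; rw [hpy]; simp)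
  have hne : form K (geo K p v (s - t)) y ≠ 1 := by
    rw [hpy]
    rcases hK with rfl | rfl
    · simp only [cosK_one]; nlinarith
    · simp only [cosK_neg_one]
      have : 1 < Real.cosh t := Real.one_lt_cosh.2 ht0.ne'
      nlinarith [Real.one_le_cosh r]
  set ρ := rdist K (geo K p v (s - t)) y with hρ
  have hρ0 : 0 < ρ := by
    refine lt_of_le_of_ne (rdist_nonneg hK (hS h1) (hS h3)) fun h => hne ?_
    rw [← cosK_rdist hK (hS h1) (hS h3), ← hρ, ← h, cosK_zero]
  have hρK : K = 1 → ρ < Real.pi := by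
    rintro rfl
    refine lt_of_le_of_ne rdist_le_pi fun h => ?_
    have := cosK_rdist hK (hS h1) (hS h3)
    rw [← hρ, h, cosK_one, Real.cos_pi] at this
    linarith
  have h5 := hF.metric_sub_le hG h1 h2 h3 h4 hρ0 (sinK_pos hρ0 hρK) rfl
    (rdist_congr (hpz.trans hpy.symm)) (rdist_congr (hqy.trans hpy.symm))
    (rdist_congr (hqz.trans hpy.symm))
  have h6 : y - z = (2 * sinK K r) • ν := by rw [hy, hz]; module
  have h7 : ∀ g, metric K g (y - z) = 2 * (sinK K r * metric K g ν) := fun g => by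
    rw [h6, metric, form_smul, metric]; ring
  rw [h7, h7] at h5
  rw [hpy] at hmain
  have h8 : sinK K r * (metric K (G (geo K p v (s + t))) ν - metric K (G (geo K p v (s - t))) ν)
      ≤ L * (ρ * sinK K ρ) := by linarith
  calc _ ≤ Real.cos t * Real.cos r * (L * (ρ * sinK K ρ)) :=
        mul_le_mul_of_nonneg_left h8 (by positivity)
    _ = L * (Real.cos t * Real.cos r * (ρ * sinK K ρ)) := by ring
    _ ≤ _ := mul_le_mul_of_nonneg_left hmain hL

/-- A perpendicular step of length r changes the form with x₀ by at most the left side of `hr`, so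
the depth of m pays for it. -/
theorem perp_mem_cball {K : ℝ} (hK : K = 1 ∨ K = -1) {x₀ : Amb d} (hx₀ : x₀ ∈ space K d)
    {R : ℝ} (hR : 0 ≤ R) (hRK : K = 1 → R ≤ Real.pi) {m ν : Amb d} (hm : m ∈ cball K x₀ R)
    (hmν : form K m ν = 0) (hν : form K ν ν = K) {r : ℝ} (hr0 : 0 ≤ r) (hr1 : r ≤ 1)
    (hr : (Real.cosh R + 2 * |form K x₀ ν|) * r ≤ K * (form K x₀ m - cosK K R)) :
    cosK K r • m + sinK K r • ν ∈ cball K x₀ R := by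
  have hspace := geo_mem_space hK hm.1 ⟨hmν, hν⟩ r
  change geo K m ν r ∈ _
  rw [mem_cball_iff hK hx₀ hR hRK hspace, form_geo]
  have h1 := abs_cosK_sub_one_le hK hr0 hr1
  have h2 := abs_sinK_le hK hr0 hr1
  have h3 := abs_form_le_cosh hK hx₀ hm
  have h4 : |K * ((cosK K r - 1) * form K x₀ m + sinK K r * form K x₀ ν)| ≤
      (Real.cosh R + 2 * |form K x₀ ν|) * r := by
    have hK1 : |K| = 1 := by rcases hK with rfl | rfl <;> simp
    rw [abs_mul, hK1, one_mul]
    refine (abs_add_le _ _).trans ?_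
    rw [abs_mul, abs_mul]
    have h5 := mul_le_mul h1 h3 (abs_nonneg _) hr0
    have h6 := mul_le_mul_of_nonneg_right h2 (abs_nonneg (form K x₀ ν))
    linarith
  have h5 := (abs_le.1 h4).1
  linarith

theorem cosK_pos_of_lt {K : ℝ} (hK : K = 1 ∨ K = -1) {R : ℝ} (hR : 0 < R)
    (hRK : K = 1 → R < Real.pi / 2) : 0 < cosK K R := by
  rcases hK with rfl | rfl
  · rw [cosK_one]
    exact Real.cos_pos_of_mem_Ioo ⟨by linarith [Real.pi_pos], hRK rfl⟩
  · rw [cosK_neg_one]; exact Real.cosh_pos _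

theorem half_mul_le_sinK {K : ℝ} (hK : K = 1 ∨ K = -1) {r : ℝ} (hr0 : 0 ≤ r) (hr1 : r ≤ 1) :
    r / 2 ≤ sinK K r := by
  rcases hK with rfl | rfl
  · rw [sinK_one]
    have h := Real.mul_le_sin hr0 (by linarith [Real.pi_gt_three])
    have h2 : 1 / 2 ≤ 2 / Real.pi := by
      rw [div_le_div_iff₀ (by norm_num) Real.pi_pos]; linarith [Real.pi_le_four]
    nlinarith
  · rw [sinK_neg_one]
    linarith [Real.self_le_sinh_iff.2 hr0]

theorem half_le_cos {r : ℝ} (hr0 : 0 ≤ r) (hr1 : r ≤ 1) : 1 / 2 ≤ Real.cos r := by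
  nlinarith [Real.one_sub_sq_div_two_le_cos (x := r)]

theorem hasDerivAt_sinK {K : ℝ} (t : ℝ) : HasDerivAt (sinK K) (cosK K t) t := by
  by_cases h : K = 1
  · have e : sinK K = Real.sin := by ext; simp [sinK, h]
    rw [e, cosK, if_pos h]; exact Real.hasDerivAt_sin t
  · have e : sinK K = Real.sinh := by ext; simp [sinK, h]
    rw [e, cosK, if_neg h]; exact Real.hasDerivAt_sinh t

theorem differentiable_cosK {K : ℝ} : Differentiable ℝ (cosK K) := by
  by_cases h : K = 1
  · have e : cosK K = Real.cos := by ext; simp [cosK, h]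
    rw [e]; exact Real.differentiable_cos
  · have e : cosK K = Real.cosh := by ext; simp [cosK, h]
    rw [e]; exact Real.differentiable_cosh

/-- After division by sinK t both sides vanish at 0, with derivatives 2L on the left and 2C on the
right. -/
theorem exists_fine_scale {K : ℝ} (hK : K = 1 ∨ K = -1) {L C : ℝ} (hC : L < C) :
    ∃ η > 0, ∀ t, 0 < t → t < η →
      L * (K * (1 - (cosK K t * cosK K t) ^ 2)) ≤
        C * (2 * t) * (Real.cos t * Real.cos t * sinK K t) := by
  set φ : ℝ → ℝ := fun t => C * (2 * t) * (Real.cos t * Real.cos t) -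
    L * (sinK K t * (1 + cosK K t ^ 2)) with hφ
  have hd : HasDerivAt φ (2 * C - 2 * L) 0 := by
    have h1 : HasDerivAt (fun t => C * (2 * t)) (C * (2 * 1)) (0 : ℝ) :=
      ((hasDerivAt_id 0).const_mul 2).const_mul C
    have h2 := (Real.hasDerivAt_cos 0).mul (Real.hasDerivAt_cos 0)
    have h3 := ((differentiable_cosK (K := K)) 0).hasDerivAt.pow 2
    have h4 := (h1.mul h2).sub (((hasDerivAt_sinK (K := K) 0).mul (h3.const_add 1)).const_mul L)
    refine h4.congr_deriv ?_
    simp; ring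
  have hpos : (0 : ℝ) < 2 * C - 2 * L := by linarith
  have hev := (hasDerivAt_iff_tendsto_slope.1 hd).eventually (lt_mem_nhds hpos)
  rw [eventually_nhdsWithin_iff, Metric.eventually_nhds_iff] at hev
  obtain ⟨ε, hε, h⟩ := hev
  refine ⟨min ε 1, by positivity, fun t ht0 htη => ?_⟩
  have htε := lt_of_lt_of_le htη (min_le_left _ _)
  have ht1 := lt_of_lt_of_le htη (min_le_right _ _)
  have h1 := h (y := t) (by rw [Real.dist_eq, sub_zero, abs_of_pos ht0]; exact htε) ht0.ne'
  have h0 : φ 0 = 0 := by simp [hφ]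
  rw [slope_def_field, h0, sub_zero, sub_zero, lt_div_iff₀ ht0, zero_mul] at h1
  have hs := half_mul_le_sinK hK ht0.le ht1.le
  have h2 := cosK_sq_add hK t
  have h3 : K * (1 - (cosK K t * cosK K t) ^ 2) = sinK K t * (sinK K t * (1 + cosK K t ^ 2)) := by
    have h4 : (1 - cosK K t ^ 2) = K * sinK K t ^ 2 := by linarith
    calc _ = K * ((1 - cosK K t ^ 2) * (1 + cosK K t ^ 2)) := by ring
      _ = (K * K) * (sinK K t * (sinK K t * (1 + cosK K t ^ 2))) := by rw [h4]; ring
      _ = _ := by rw [mul_self_eq_one hK, one_mul]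
  have h5 : 0 ≤ sinK K t * φ t := mul_nonneg (by linarith) h1.le
  rw [h3]
  simp only [hφ] at h5
  linarith

/-- A component of the gradient normal to the geodesic from a critical point grows at rate `L`. -/
theorem IsSmoothOn.normal_le {K : ℝ} (hK : K = 1 ∨ K = -1) {x₀ : Amb d} (hx₀ : x₀ ∈ space K d)
    {R : ℝ} (hR : 0 < R) (hRK : K = 1 → R < Real.pi / 2) {F : Amb d → ℝ} {G : Amb d → Amb d}
    {L : ℝ} (hL : 0 ≤ L) (hF : IsSmoothOn K (cball K x₀ R) F G L)
    (hG : ∀ x ∈ cball K x₀ R, form K x (G x) = 0) {p v ν : Amb d} (hp : p ∈ cball K x₀ R)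
    (hGp : G p = 0) (hv : IsUnitTangent K p v) (hν : form K ν ν = K) (hpν : form K p ν = 0)
    (hvν : form K v ν = 0) {D : ℝ} (hD : 0 < D) (hDK : K = 1 → D < Real.pi)
    (hint : 0 < K * (form K x₀ (geo K p v D) - cosK K R)) :
    metric K (G (geo K p v D)) ν ≤ L * D := by
  have hRpi : K = 1 → R ≤ Real.pi := fun h => by linarith [hRK h, Real.pi_pos]
  have hps := hp.1
  have hp0 := (mem_cball_iff hK hx₀ hR.le hRpi hps).1 hp
  obtain ⟨κ₀, hκ₀, hdepth⟩ := exists_depth hK (cosK_pos_of_lt hK hR hRK) hp0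
    (by rwa [form_geo] at hint) hD hDK
  simp only [← form_geo] at hdepth
  have hmem : ∀ s, 0 ≤ s → s ≤ D → geo K p v s ∈ cball K x₀ R := fun s h0 h1 => by
    rw [mem_cball_iff hK hx₀ hR.le hRpi (geo_mem_space hK hps hv s)]
    exact (by positivity : 0 ≤ κ₀ * s).trans (hdepth s h0 h1)
  set b := Real.cosh R + 2 * |form K x₀ ν| with hb
  have hb0 : 0 < b := by have := Real.cosh_pos R; positivity
  have hn : ∀ u, form K (geo K p v u) ν = 0 := fun u => by
    rw [form_comm, form_geo, form_comm K ν, hpν, form_comm K ν, hvν]; ring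
  -- With this κ, kites centred at parameter s with half-width r ≤ κ s stay in the ball.
  set κ := min (κ₀ / b) 1 with hκ
  have hκ0 : 0 < κ := lt_min (by positivity) one_pos
  set n : ℝ → ℝ := fun s => metric K (G (geo K p v s)) ν with hndef
  have hstep : ∀ s t r, 0 < t → t ≤ 1 → 0 < r → r ≤ 1 → r ≤ κ * s → 0 ≤ s - t → s + t ≤ D →
      Real.cos t * Real.cos r * (sinK K r * (n (s + t) - n (s - t))) ≤
        L * (K * (1 - (cosK K t * cosK K r) ^ 2)) := by
    intro s t r ht0 ht1 hr0 hr1 hrs hst hstD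
    have hs0 : 0 ≤ s := by linarith
    have h1 : b * r ≤ K * (form K x₀ (geo K p v s) - cosK K R) := by
      refine le_trans ?_ (hdepth s hs0 (by linarith))
      have h2 : κ ≤ κ₀ / b := min_le_left _ _
      rw [le_div_iff₀ hb0] at h2
      calc b * r ≤ b * (κ * s) := mul_le_mul_of_nonneg_left hrs hb0.le
        _ = κ * b * s := by ring
        _ ≤ _ := mul_le_mul_of_nonneg_right h2 hs0
    have hms := hmem s hs0 (by linarith)
    have hy := perp_mem_cball hK hx₀ hR.le hRpi hms (hn s) hν hr0.le hr1 h1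
    have hz := perp_mem_cball hK hx₀ hR.le hRpi hms (ν := -ν)
      (by rw [form_neg, hn, neg_zero])
      (by rw [form_neg, form_comm, form_neg, neg_neg, hν]) hr0.le hr1
      (by rw [form_neg, abs_neg]; exact h1)
    rw [smul_neg, ← sub_eq_add_neg] at hz
    exact hF.normal_step hK (fun _ h => h.1) hL hG hps hv hpν hvν ht0 ht1 hr0 hr1
      (hmem _ hst (by linarith)) (hmem _ (by linarith) hstD) hy hz
  have hn0 : n 0 = 0 := by simp [hndef, geo, hGp, metric, form]
  -- Thin kite with one vertex at the critical point, r = κ t. The constant is crude; what matters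
  -- is that the bound tends to 0 with t.
  have hstart : ∀ t, 0 < t → t ≤ 1 → 2 * t ≤ D → n (2 * t) ≤ 160 * L / κ * t := by
    intro t ht0 ht1 htD
    have hκ1 : κ ≤ 1 := min_le_right _ _
    have hr0 : 0 < κ * t := by positivity
    have hrt : κ * t ≤ t := by nlinarith
    have hr1 : κ * t ≤ 1 := by linarith
    have h := hstep t t (κ * t) ht0 ht1 hr0 hr1 le_rfl (by simp) (by linarith)
    rw [sub_self, hn0, sub_zero, ← two_mul] at h
    set r := κ * t with hr
    by_contra hcon
    push Not at hcon
    have hnpos : 0 ≤ 160 * L / κ * t := by positivity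
    have c1 := half_le_cos ht0.le ht1
    have c2 := half_le_cos hr0.le hr1
    have c3 := half_mul_le_sinK hK hr0.le hr1
    have hA : 1 / 4 * (r / 2) ≤ Real.cos t * Real.cos r * sinK K r := by
      refine mul_le_mul ?_ c3 (by positivity) (by positivity)
      nlinarith
    have hB : L * (K * (1 - (cosK K t * cosK K r) ^ 2)) ≤ L * (20 * t ^ 2) := by
      refine mul_le_mul_of_nonneg_left ?_ hL
      have e : K * (1 - (cosK K t * cosK K r) ^ 2) =
          sinK K t ^ 2 + sinK K r ^ 2 * cosK K t ^ 2 := by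
        have q1 := cosK_sq_add hK t
        have q2 := cosK_sq_add hK r
        have q3 := mul_self_eq_one hK
        linear_combination (-K) * q1 - (K * cosK K t ^ 2) * q2 +
          (sinK K t ^ 2 + sinK K r ^ 2 * cosK K t ^ 2) * q3
      rw [e]
      have s1 := abs_sinK_le hK ht0.le ht1
      have s2 := (abs_sinK_le hK hr0.le hr1).trans (by linarith : 2 * r ≤ 2 * t)
      have s3 := abs_le.1 (abs_cosK_sub_one_le hK ht0.le ht1)
      have s4 : |cosK K t| ≤ 2 := abs_le.2 ⟨by linarith, by linarith⟩
      have t1 := sq_le_sq' (abs_le.1 s1).1 (abs_le.1 s1).2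
      have t2 := sq_le_sq' (abs_le.1 s2).1 (abs_le.1 s2).2
      have t3 := sq_le_sq' (abs_le.1 s4).1 (abs_le.1 s4).2
      have := mul_le_mul t2 t3 (sq_nonneg _) (by positivity)
      linarith
    have hC : 1 / 4 * (r / 2) * n (2 * t) ≤ L * (20 * t ^ 2) := by
      refine le_trans (mul_le_mul_of_nonneg_right hA (by linarith)) ?_
      linarith
    have hE : 1 / 4 * (r / 2) * (160 * L / κ * t) = L * (20 * t ^ 2) := by
      rw [hr]; field_simp; ring
    have hF' := mul_lt_mul_of_pos_left hcon (by positivity : 0 < 1 / 4 * (r / 2))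
    linarith
  -- Away from the start the depth is bounded below, so kites with r = t fit and give every rate C >
  -- L.
  have hfine : ∀ C, L < C → ∀ a, 0 < a → a ≤ D → n D - n a ≤ C * (D - a) := by
    intro C hC a ha haD
    obtain ⟨η, hη, hsc⟩ := exists_fine_scale hK hC
    have hm : 0 < min (min η 1) (κ * a) := by positivity
    refine sub_le_of_locally_sub_le haD hm fun s₁ s₂ h1 h12 h2 hη' => ?_
    have q1 := hη'.trans ((min_le_left _ _).trans (min_le_left _ _))
    have q2 := hη'.trans ((min_le_left _ _).trans (min_le_right _ _))
    have q3 := hη'.trans (min_le_right _ _)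
    set t := (s₂ - s₁) / 2 with ht
    have ht0 : 0 < t := by rw [ht]; linarith
    have hs : κ * a ≤ κ * ((s₁ + s₂) / 2) :=
      mul_le_mul_of_nonneg_left (by linarith) hκ0.le
    have h := hstep ((s₁ + s₂) / 2) t t ht0 (by linarith) ht0 (by linarith) (by linarith)
      (by linarith) (by linarith)
    have e1 : (s₁ + s₂) / 2 + t = s₂ := by rw [ht]; ring
    have e2 : (s₁ + s₂) / 2 - t = s₁ := by rw [ht]; ring
    rw [e1, e2] at h
    have h' := h.trans (hsc t ht0 (by linarith))
    have hpos : 0 < Real.cos t * Real.cos t * sinK K t := by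
      have c1 := half_le_cos ht0.le (by linarith)
      have c3 := half_mul_le_sinK hK ht0.le (by linarith)
      have : 0 < sinK K t := by linarith
      have : 0 < Real.cos t := by linarith
      positivity
    have e3 : s₂ - s₁ = 2 * t := by rw [ht]; ring
    rw [e3]
    refine le_of_mul_le_mul_left ?_ hpos
    linarith
  change n D ≤ L * D
  refine le_of_forall_pos_le_add fun ε hε => ?_
  -- Half of ε pays for C > L over the length D, the other half for the initial piece, since A t ≤ ε
  -- / 2.
  set C := L + ε / (2 * D) with hC
  have hC0 : L < C := by rw [hC]; have : 0 < ε / (2 * D) := by positivity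
                         linarith
  set A := 160 * L / κ with hA
  have hA0 : 0 ≤ A := by positivity
  set t := min (min 1 (D / 2)) (ε / (2 * (A + 1))) with ht
  have ht0 : 0 < t := by positivity
  have t1 : t ≤ 1 := (min_le_left _ _).trans (min_le_left _ _)
  have t2 : t ≤ D / 2 := (min_le_left _ _).trans (min_le_right _ _)
  have t3 : t ≤ ε / (2 * (A + 1)) := min_le_right _ _
  rw [le_div_iff₀ (by positivity)] at t3
  have h1 := hstart t ht0 t1 (by linarith)
  have h2 := hfine C hC0 (2 * t) (by positivity) (by linarith)
  have h3 : C * D = L * D + ε / 2 := by rw [hC]; field_simp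
  have h4 : 0 ≤ C * (2 * t) := by positivity
  nlinarith

/-! ### Cauchy-Schwarz on tangent spaces and the triangle inequality -/

theorem form_zero_left (K : ℝ) (p : Amb d) : form K 0 p = 0 := by simp [form]

theorem form_zero_right (K : ℝ) (p : Amb d) : form K p 0 = 0 := by simp [form]

/-- The metric is positive semidefinite on tangent spaces. -/
theorem metric_self_nonneg {K : ℝ} (hK : K = 1 ∨ K = -1) {p w : Amb d} (hp : p ∈ space K d)
    (hw : form K p w = 0) : 0 ≤ K * form K w w ∧ (K * form K w w = 0 → w = 0) := by
  have h1 := hp.1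
  simp only [form, real_inner_self_eq_norm_sq] at h1 hw ⊢
  have hz : ‖w.1‖ ^ 2 = 0 → w.2 = 0 → w = 0 := fun ha hb => by
    refine Prod.ext ?_ hb
    simpa using ha
  rcases hK with rfl | rfl
  · refine ⟨by nlinarith [sq_nonneg w.2, sq_nonneg ‖w.1‖], fun h => hz ?_ ?_⟩
    · nlinarith [sq_nonneg w.2, sq_nonneg ‖w.1‖]
    · nlinarith [sq_nonneg w.2, sq_nonneg ‖w.1‖]
  · have hcs := abs_real_inner_le_norm p.1 w.1
    have h2 : inner ℝ p.1 w.1 = p.2 * w.2 := by linarith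
    rw [h2] at hcs
    have h3 : (p.2 * w.2) ^ 2 ≤ (‖p.1‖ * ‖w.1‖) ^ 2 := sq_le_sq.2 (by
      rwa [abs_of_nonneg (by positivity : 0 ≤ ‖p.1‖ * ‖w.1‖)])
    have h4 : p.2 ^ 2 = 1 + ‖p.1‖ ^ 2 := by linarith
    have h5 : w.2 ^ 2 ≤ ‖p.1‖ ^ 2 * (‖w.1‖ ^ 2 - w.2 ^ 2) := by
      rw [mul_pow, h4] at h3; nlinarith
    have h6 : 0 ≤ ‖w.1‖ ^ 2 - w.2 ^ 2 := by
      by_contra hcon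
      push Not at hcon
      nlinarith [sq_nonneg ‖p.1‖, sq_nonneg w.2, sq_nonneg ‖w.1‖]
    refine ⟨by linarith, fun h => ?_⟩
    have h7 : ‖w.1‖ ^ 2 - w.2 ^ 2 = 0 := by linarith
    rw [h7, mul_zero] at h5
    have h8 : w.2 = 0 := by nlinarith
    exact hz (by rw [h8] at h7; linarith) h8

theorem metric_sq_le {K : ℝ} (hK : K = 1 ∨ K = -1) {p u w : Amb d} (hp : p ∈ space K d)
    (hu : form K p u = 0) (hw : form K p w = 0) :
    form K u w ^ 2 ≤ (K * form K u u) * (K * form K w w) := by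
  obtain ⟨h1, h2⟩ := metric_self_nonneg hK hp hw
  rcases h1.eq_or_lt with h0 | hpos
  · rw [h2 h0.symm, form_zero_right, form_zero_right]; simp
  have h3 := (metric_self_nonneg hK hp (w := (K * form K w w) • u - (K * form K u w) • w) (by
    rw [form_sub, form_smul, form_smul, hu, hw]; ring)).1
  have h4 : K * form K ((K * form K w w) • u - (K * form K u w) • w)
      ((K * form K w w) • u - (K * form K u w) • w) =
      (K * form K w w) * ((K * form K u u) * (K * form K w w) - form K u w ^ 2) := by
    simp only [form_sub, form_smul, form_sub_left, form_smul_left, form_comm K w u]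
    linear_combination (-K * form K w w * form K u w ^ 2) * mul_self_eq_one hK
  rw [h4] at h3
  have := nonneg_of_mul_nonneg_right h3 hpos
  linarith

/-- Cauchy-Schwarz for the parts of x and y tangent at z, combined with the addition formula. The
bound by π keeps the sum where cos is monotone. -/
theorem rdist_triangle {K : ℝ} (hK : K = 1 ∨ K = -1) {z x y : Amb d} (hz : z ∈ space K d)
    (hx : x ∈ space K d) (hy : y ∈ space K d) (hpi : K = 1 → rdist K z x + rdist K z y ≤ Real.pi) :
    rdist K x y ≤ rdist K z x + rdist K z y := by
  have ha := rdist_nonneg hK hz hx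
  have hb := rdist_nonneg hK hz hy
  have hC := cosK_rdist hK hz hx
  have hC' := cosK_rdist hK hz hy
  set a := rdist K z x with had
  set b := rdist K z y with hbd
  rw [← cosK_le_cosK_iff hK (rdist_nonneg hK hx hy) (by linarith) _ hpi, cosK_rdist hK hx hy]
  swap
  · rintro rfl; exact rdist_le_pi
  have h1 := metric_sq_le hK hz (u := x - cosK K a • z) (w := y - cosK K b • z)
    (by rw [form_sub, form_smul, hz.1, hC]; ring) (by rw [form_sub, form_smul, hz.1, hC']; ring)
  simp only [form_sub, form_smul, form_sub_left, form_smul_left, form_comm K x z, form_comm K y z,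
    ← hC, ← hC', hz.1, hx.1, hy.1] at h1
  have hsa : 0 ≤ sinK K a := by
    rcases ha.eq_or_lt with h | h
    · rw [← h, sinK_zero]
    · rcases hK with rfl | rfl
      · rw [sinK_one]; exact Real.sin_nonneg_of_nonneg_of_le_pi ha rdist_le_pi
      · exact (sinK_pos h (fun h => absurd h neg_one_ne_one)).le
  have hsb : 0 ≤ sinK K b := by
    rcases hb.eq_or_lt with h | h
    · rw [← h, sinK_zero]
    · rcases hK with rfl | rfl
      · rw [sinK_one]; exact Real.sin_nonneg_of_nonneg_of_le_pi hb rdist_le_pi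
      · exact (sinK_pos h (fun h => absurd h neg_one_ne_one)).le
  have qa := cosK_sq_add hK a
  have qb := cosK_sq_add hK b
  have h2 : (form K x y - cosK K a * cosK K b) ^ 2 ≤ (sinK K a * sinK K b) ^ 2 := by
    refine le_trans (le_of_eq (by ring)) (h1.trans (le_of_eq ?_))
    have e1 : 1 - cosK K a ^ 2 = K * sinK K a ^ 2 := by linarith
    have e2 : 1 - cosK K b ^ 2 = K * sinK K b ^ 2 := by linarith
    calc _ = (K * (1 - cosK K a ^ 2)) * (K * (1 - cosK K b ^ 2)) := by ring
      _ = (K * K) * (K * K) * (sinK K a * sinK K b) ^ 2 := by rw [e1, e2]; ring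
      _ = _ := by rw [mul_self_eq_one hK]; ring
  have h3 := abs_le.1 (abs_le_of_sq_le_sq h2 (by positivity))
  have h4 : cosK K (a + b) = cosK K a * cosK K b - K * (sinK K a * sinK K b) := by
    have := cosK_sub hK a (-b)
    rw [sub_neg_eq_add, cosK_neg, sinK_neg] at this
    rw [this]; ring
  rw [h4]
  rcases hK with rfl | rfl <;> linarith

theorem eq_of_rdist_eq_zero {K : ℝ} (hK : K = 1 ∨ K = -1) {x y : Amb d} (hx : x ∈ space K d)
    (hy : y ∈ space K d) (h : rdist K x y = 0) : x = y := by
  have hC := cosK_rdist hK hx hy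
  rw [h, cosK_zero] at hC
  have h1 := (metric_self_nonneg hK hx (w := y - x) (by rw [form_sub, hx.1, ← hC]; ring)).2 (by
    simp only [form_sub, form_sub_left, form_comm K y x, hx.1, hy.1, ← hC]; ring)
  exact (sub_eq_zero.1 h1).symm

theorem IsUnitTangent.geo {K : ℝ} (hK : K = 1 ∨ K = -1) {p v : Amb d} (hp : p ∈ space K d)
    (hv : IsUnitTangent K p v) (s : ℝ) :
    IsUnitTangent K (geo K p v s) (cosK K s • v - (K * sinK K s) • p) := by
  have h1 := cosK_sq_add hK s
  constructor
  · simp only [SpaceForm.geo, form_sub, form_smul, form_add_left, form_smul_left, hp.1, hv.tangent,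
      hv.unit, form_comm K v p]
    ring
  · simp only [form_sub, form_smul, form_sub_left, form_smul_left, hp.1, hv.tangent,
      hv.unit, form_comm K v p]
    linear_combination K * h1

/-! ### The gradient bound -/

/-- Source of the √2: a unit vector is split into a velocity part and a normal part, and the two are
bounded separately. -/
theorem abs_add_sqrt_le {c q : ℝ} (hq : 0 ≤ q) (h : c ^ 2 + q = 1) : |c| + √q ≤ √2 := by
  refine Real.le_sqrt_of_sq_le ?_
  have := Real.sq_sqrt hq
  nlinarith [sq_nonneg (|c| - √q), sq_abs c]

/-- The gradient bound at interior points of the ball. -/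
theorem IsSmoothOn.abs_metric_le_of_interior {K : ℝ} (hK : K = 1 ∨ K = -1) {x₀ : Amb d}
    (hx₀ : x₀ ∈ space K d) {R : ℝ} (hR : 0 < R) (hRK : K = 1 → R < Real.pi / 2) {F : Amb d → ℝ}
    {G : Amb d → Amb d} {L : ℝ} (hL : 0 ≤ L) (hF : IsSmoothOn K (cball K x₀ R) F G L)
    (hG : ∀ x ∈ cball K x₀ R, form K x (G x) = 0) {p : Amb d} (hp : p ∈ cball K x₀ R)
    (hGp : G p = 0) {x T : Amb d} (hx : x ∈ cball K x₀ R)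
    (hint : 0 < K * (form K x₀ x - cosK K R)) (hT : IsUnitTangent K x T) :
    |metric K (G x) T| ≤ √2 * (L * (2 * R)) := by
  have hD2 : rdist K p x ≤ 2 * R := by
    refine (rdist_triangle hK hx₀ hp.1 hx.1 fun h => ?_).trans (by linarith [hp.2, hx.2])
    linarith [hp.2, hx.2, hRK h]
  have hD0 := rdist_nonneg hK hp.1 hx.1
  rcases hD0.eq_or_lt with h0 | hD
  · have := eq_of_rdist_eq_zero hK hp.1 hx.1 h0.symm
    rw [← this, hGp, metric, form_zero_left, mul_zero, abs_zero]
    positivity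
  have hDK : K = 1 → rdist K p x < Real.pi := fun h => by linarith [hRK h]
  obtain ⟨v, hv, hvx⟩ := exists_geo hK hp.1 hx.1 hD hDK
  set D := rdist K p x with hDdef
  have hU := hv.geo hK hp.1 D
  have hpar := hF.abs_metric_geo_sub_le hK hG hp.1 hv hD hDK hp (by rwa [hvx])
  set U := cosK K D • v - (K * sinK K D) • p with hUd
  rw [hvx] at hU hpar
  rw [hGp, metric, metric, form_zero_left, mul_zero, sub_zero] at hpar
  set c := K * form K U T with hc
  set w := T - c • U with hw
  have hK2 := mul_self_eq_one hK
  have hcs := cosK_sq_add hK D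
  have hwx : form K x w = 0 := by
    rw [hw, form_sub, form_smul, hT.tangent, hU.tangent]; ring
  have hwU : form K U w = 0 := by
    rw [hw, form_sub, form_smul, hU.unit, hc]
    linear_combination (-form K U T) * hK2
  -- The pairs (p, v) and (x, U) span the same plane, so w, orthogonal to x and U, is also normal to
  -- the geodesic at p.
  have hpe : p = cosK K D • x - sinK K D • U := by
    rw [← hvx, geo, hUd]
    calc p = (cosK K D ^ 2 + K * sinK K D ^ 2) • p := by rw [hcs, one_smul]
      _ = _ := by module
  have hve : v = (K * sinK K D) • x + cosK K D • U := by
    rw [← hvx, geo, hUd]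
    calc v = (cosK K D ^ 2 + K * sinK K D ^ 2) • v := by rw [hcs, one_smul]
      _ = _ := by module
  have hpw : form K p w = 0 := by
    rw [hpe, form_sub_left, form_smul_left, form_smul_left, hwx, hwU]; ring
  have hvw : form K v w = 0 := by
    rw [hve, form_add_left, form_smul_left, form_smul_left, hwx, hwU]; ring
  obtain ⟨hq0, hq1⟩ := metric_self_nonneg hK hx.1 hwx
  set q := K * form K w w with hq
  have hcq : c ^ 2 + q = 1 := by
    have hTw : form K w w = form K T w := by
      conv_lhs => rw [hw, form_sub_left, form_smul_left, ← hw, hwU]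
      ring
    rw [hq, hTw, hw, form_sub, form_smul, hT.unit, form_comm K T U]
    have hcU : form K U T = K * c := by rw [hc, ← mul_assoc, hK2, one_mul]
    rw [hcU]
    linear_combination (1 - c ^ 2) * hK2
  have hnorm : |metric K (G x) w| ≤ √q * (L * D) := by
    rcases hq0.eq_or_lt with h | hqpos
    · rw [hq1 h.symm, metric, form_zero_right, mul_zero, abs_zero]; positivity
    have hsq : 0 < √q := Real.sqrt_pos.2 hqpos
    have hunit : ∀ σ : ℝ, σ ^ 2 = 1 → metric K (G x) ((σ * (√q)⁻¹) • w) ≤ L * D := by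
      intro σ hσ
      have := hF.normal_le hK hx₀ hR hRK hL hG hp hGp hv (ν := (σ * (√q)⁻¹) • w)
        (by
          rw [form_smul, form_smul_left]
          have : form K w w = K * q := by rw [hq, ← mul_assoc, hK2, one_mul]
          rw [this]
          have h2 := Real.sq_sqrt hq0
          calc _ = σ ^ 2 * K * (q * ((√q)⁻¹) ^ 2) := by ring
            _ = K := by rw [hσ, inv_pow, h2, mul_inv_cancel₀ hqpos.ne']; ring)
        (by rw [form_smul, hpw, mul_zero]) (by rw [form_smul, hvw, mul_zero]) hD hDK
        (by rwa [hvx])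
      rwa [hvx] at this
    have u1 := hunit 1 (by norm_num)
    have u2 := hunit (-1) (by norm_num)
    rw [metric, form_smul] at u1 u2
    have e : metric K (G x) w = √q * (K * (1 * (√q)⁻¹ * form K (G x) w)) := by
      rw [metric]; field_simp
    rw [e, abs_mul, abs_of_pos hsq]
    refine mul_le_mul_of_nonneg_left (abs_le.2 ⟨?_, u1⟩) hsq.le
    linarith
  have hsplit : metric K (G x) T = c * (K * form K (G x) U) + metric K (G x) w := by
    have : T = c • U + w := by rw [hw]; module
    rw [metric, metric]
    conv_lhs => rw [this, form_add, form_smul]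
    ring
  rw [hsplit]
  calc _ ≤ |c| * (L * D) + √q * (L * D) := by
        refine (abs_add_le _ _).trans (add_le_add ?_ hnorm)
        rw [abs_mul]
        exact mul_le_mul_of_nonneg_left hpar (abs_nonneg _)
    _ = (|c| + √q) * (L * D) := by ring
    _ ≤ √2 * (L * (2 * R)) := by
        refine mul_le_mul (abs_add_sqrt_le hq0 hcq) ?_ (by positivity) (by positivity)
        exact mul_le_mul_of_nonneg_left hD2 hL

/-- The gradient bound along geodesics that stay in the ball. -/
theorem IsSmoothOn.abs_metric_le {K : ℝ} (hK : K = 1 ∨ K = -1) {x₀ : Amb d}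
    (hx₀ : x₀ ∈ space K d) {R : ℝ} (hR : 0 < R) (hRK : K = 1 → R < Real.pi / 2) {F : Amb d → ℝ}
    {G : Amb d → Amb d} {L : ℝ} (hL : 0 ≤ L) (hF : IsSmoothOn K (cball K x₀ R) F G L)
    (hG : ∀ x ∈ cball K x₀ R, form K x (G x) = 0) {p : Amb d} (hp : p ∈ cball K x₀ R)
    (hGp : G p = 0) {x v : Amb d} (hx : x ∈ cball K x₀ R) (hv : IsUnitTangent K x v) {D : ℝ}
    (hD : 0 < D) (hDK : K = 1 → D < Real.pi) (hy : geo K x v D ∈ cball K x₀ R) :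
    |metric K (G x) v| ≤ √2 * (L * (2 * R)) := by
  have hRpi : K = 1 → R ≤ Real.pi := fun h => by linarith [hRK h, Real.pi_pos]
  have hx0 := (mem_cball_iff hK hx₀ hR.le hRpi hx.1).1 hx
  have hy0 := (mem_cball_iff hK hx₀ hR.le hRpi hy.1).1 hy
  rw [form_geo] at hy0
  refine le_of_forall_pos_le_add fun ε hε => ?_
  -- Move an interior distance s along the geodesic: the velocity component changes by at most L s ≤
  -- ε.
  set s := min (D / 2) (ε / (L + 1)) with hs
  have hs0 : 0 < s := by positivity
  have hsD : s < D := (min_le_left _ _).trans_lt (by linarith)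
  have hsε : s ≤ ε / (L + 1) := min_le_right _ _
  rw [le_div_iff₀ (by positivity)] at hsε
  have hint := interior_of_geo hK (cosK_pos_of_lt hK hR hRK) hx0 hy0 hs0 hsD hDK
  rw [← form_geo] at hint
  have hmem : geo K x v s ∈ cball K x₀ R :=
    (mem_cball_iff hK hx₀ hR.le hRpi (geo_mem_space hK hx.1 hv s)).2 hint.le
  have h1 := hF.abs_metric_le_of_interior hK hx₀ hR hRK hL hG hp hGp hmem hint (hv.geo hK hx.1 s)
  have h2 := hF.abs_metric_geo_sub_le hK hG hx.1 hv hs0 (fun h => by linarith [hDK h]) hx hmem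
  have h3 := abs_sub_abs_le_abs_sub (metric K (G x) v)
    (metric K (G (geo K x v s)) (cosK K s • v - (K * sinK K s) • x))
  rw [abs_sub_comm] at h3
  nlinarith

/-! ### Taylor estimates and geodesic length along a Euclidean line -/

theorem sub_le_of_hasDerivAt_le {g g' : ℝ → ℝ} {a b : ℝ} (hab : a ≤ b)
    (hg : ∀ x, a ≤ x → x ≤ b → HasDerivAt g (g' x) x) (hle : ∀ x, a ≤ x → x ≤ b → g' x ≤ 0) :
    g b ≤ g a := by
  refine antitoneOn_of_deriv_nonpos (convex_Icc a b) (f := g)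
    (fun x hx => (hg x hx.1 hx.2).continuousAt.continuousWithinAt) ?_ ?_ ⟨le_rfl, hab⟩ ⟨hab, le_rfl⟩
    hab
  · intro x hx
    rw [interior_Icc] at hx
    exact (hg x hx.1.le hx.2.le).differentiableAt.differentiableWithinAt
  · intro x hx
    rw [interior_Icc] at hx
    rw [(hg x hx.1.le hx.2.le).deriv]
    exact hle x hx.1.le hx.2.le

theorem sub_le_mul_of_hasDerivAt {S σ : ℝ → ℝ} {a b A : ℝ} (hab : a ≤ b)
    (hS : ∀ x, a ≤ x → x ≤ b → HasDerivAt S (σ x) x) (hA : ∀ x, a ≤ x → x ≤ b → σ x ≤ A) :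
    S b - S a ≤ A * (b - a) := by
  have h := sub_le_of_hasDerivAt_le (g := fun x => S x - A * x) (g' := fun x => σ x - A * 1) hab
    (fun x h1 h2 => (hS x h1 h2).sub ((hasDerivAt_id x).const_mul A))
    (fun x h1 h2 => by linarith [hA x h1 h2])
  linarith

theorem abs_taylor_two_le {S σ : ℝ → ℝ} {a b B : ℝ} (hab : a ≤ b)
    (hS : ∀ x, a ≤ x → x ≤ b → HasDerivAt S (σ x) x)
    (hB : ∀ x, a ≤ x → x ≤ b → |σ x - σ a| ≤ B * (x - a)) :
    |S b - S a - σ a * (b - a)| ≤ B / 2 * (b - a) ^ 2 := by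
  have hq : ∀ x, HasDerivAt (fun x => B / 2 * (x - a) ^ 2) (B / 2 * (2 * (x - a))) x := fun x => by
    have := (((hasDerivAt_id x).sub_const a).pow 2).const_mul (B / 2)
    refine this.congr_deriv ?_
    simp
  have hl : ∀ x, HasDerivAt (fun x => σ a * (x - a)) (σ a * 1) x := fun x =>
    ((hasDerivAt_id x).sub_const a).const_mul _
  have h1 := sub_le_of_hasDerivAt_le
    (g := fun x => S x - σ a * (x - a) - B / 2 * (x - a) ^ 2)
    (g' := fun x => σ x - σ a * 1 - B / 2 * (2 * (x - a))) hab
    (fun x h1 h2 => ((hS x h1 h2).sub (hl x)).sub (hq x))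
    (fun x h1 h2 => by linarith [(abs_le.1 (hB x h1 h2)).2])
  have h2 := sub_le_of_hasDerivAt_le
    (g := fun x => σ a * (x - a) - S x - B / 2 * (x - a) ^ 2)
    (g' := fun x => σ a * 1 - σ x - B / 2 * (2 * (x - a))) hab
    (fun x h1 h2 => ((hl x).sub (hS x h1 h2)).sub (hq x))
    (fun x h1 h2 => by linarith [(abs_le.1 (hB x h1 h2)).1])
  simp only [sub_self, mul_zero, ne_eq, OfNat.ofNat_ne_zero, not_false_eq_true, zero_pow] at h1 h2
  rw [abs_le]
  constructor <;> linarith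

theorem sqrt_one_add_div_sq {a τ K : ℝ} (ha : 0 < a) :
    √(a ^ 2 + K * τ ^ 2) = a * √(1 + K * (τ / a) ^ 2) := by
  rw [show a ^ 2 + K * τ ^ 2 = a ^ 2 * (1 + K * (τ / a) ^ 2) by field_simp,
    Real.sqrt_mul (by positivity), Real.sqrt_sq ha.le]

/-- A line at distance √(a² - 1) from the origin projects to a great circle on which τ ↦ arctan(τ/a)
is arc length. -/
theorem spherical_line {a τ₁ τ₂ t : ℝ} (ha : 0 < a) (hτ : τ₁ ≤ τ₂) (ht0 : 0 ≤ t)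
    (htpi : t ≤ Real.pi)
    (h : Real.cos t * (√(a ^ 2 + τ₁ ^ 2) * √(a ^ 2 + τ₂ ^ 2)) = a ^ 2 + τ₁ * τ₂) :
    t = Real.arctan (τ₂ / a) - Real.arctan (τ₁ / a) := by
  have hle : Real.arctan (τ₁ / a) ≤ Real.arctan (τ₂ / a) :=
    Real.arctan_strictMono.monotone (by gcongr)
  refine Real.injOn_cos ⟨ht0, htpi⟩ ⟨by linarith, ?_⟩ ?_
  · linarith [Real.arctan_lt_pi_div_two (τ₂ / a), Real.neg_pi_div_two_lt_arctan (τ₁ / a)]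
  · have e₁ := sqrt_one_add_div_sq (K := 1) (τ := τ₁) ha
    have e₂ := sqrt_one_add_div_sq (K := 1) (τ := τ₂) ha
    rw [one_mul, one_mul] at e₁ e₂
    rw [e₁, e₂] at h
    have p₁ : 0 < √(1 + (τ₁ / a) ^ 2) := by positivity
    have p₂ : 0 < √(1 + (τ₂ / a) ^ 2) := by positivity
    rw [Real.cos_sub, Real.cos_arctan, Real.cos_arctan, Real.sin_arctan, Real.sin_arctan]
    have : Real.cos t = (a ^ 2 + τ₁ * τ₂) / (a * √(1 + (τ₁ / a) ^ 2) * (a * √(1 + (τ₂ / a) ^ 2))) := by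
      rw [eq_div_iff (by positivity), h]
    rw [this]
    field_simp

/-- For a ≥ 1 the derivative a/(a² + x²) of arctan(x/a) is at most 1 and 1-Lipschitz. -/
theorem spherical_line_bounds {a τ₁ τ₂ t : ℝ} (ha : 1 ≤ a) (hτ : τ₁ ≤ τ₂) (ht0 : 0 ≤ t)
    (htpi : t ≤ Real.pi)
    (h : Real.cos t * (√(a ^ 2 + τ₁ ^ 2) * √(a ^ 2 + τ₂ ^ 2)) = a ^ 2 + τ₁ * τ₂) :
    t ≤ τ₂ - τ₁ ∧ |t - a / (a ^ 2 + τ₁ ^ 2) * (τ₂ - τ₁)| ≤ 1 / 2 * (τ₂ - τ₁) ^ 2 := by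
  have ha0 : 0 < a := by linarith
  have e := spherical_line ha0 hτ ht0 htpi h
  have hd : ∀ x, HasDerivAt (fun x => Real.arctan (x / a)) (a / (a ^ 2 + x ^ 2)) x := fun x => by
    have := ((hasDerivAt_id x).div_const a).arctan
    refine this.congr_deriv ?_
    simp only [id]
    field_simp
  have hpos : ∀ x, 0 < a ^ 2 + x ^ 2 := fun x => by positivity
  constructor
  · have := sub_le_mul_of_hasDerivAt (A := 1) hτ (fun x _ _ => hd x) (fun x _ _ => by
      rw [div_le_one (hpos x)]; nlinarith [sq_nonneg x])
    linarith
  · have := abs_taylor_two_le (B := 1) hτ (fun x _ _ => hd x) (fun x h1 _ => by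
      have e2 : a / (a ^ 2 + x ^ 2) - a / (a ^ 2 + τ₁ ^ 2) =
          -(a * (x + τ₁)) / ((a ^ 2 + x ^ 2) * (a ^ 2 + τ₁ ^ 2)) * (x - τ₁) := by
        have := (hpos x).ne'
        have := (hpos τ₁).ne'
        field_simp
        ring
      rw [e2, abs_mul, abs_of_nonneg (sub_nonneg.2 h1)]
      refine mul_le_mul_of_nonneg_right ?_ (sub_nonneg.2 h1)
      have hp : 0 < (a ^ 2 + x ^ 2) * (a ^ 2 + τ₁ ^ 2) := mul_pos (hpos x) (hpos τ₁)
      rw [abs_div, abs_of_pos hp, div_le_one hp, abs_neg, abs_mul, abs_of_pos ha0]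
      have t1 : a * |x| ≤ (a ^ 2 + x ^ 2) / 2 := by nlinarith [sq_nonneg (a - |x|), sq_abs x]
      have t2 : a * |τ₁| ≤ (a ^ 2 + τ₁ ^ 2) / 2 := by nlinarith [sq_nonneg (a - |τ₁|), sq_abs τ₁]
      have t3 : a * |x + τ₁| ≤ a * |x| + a * |τ₁| := by
        rw [← mul_add]; exact mul_le_mul_of_nonneg_left (abs_add_le _ _) ha0.le
      have g1 : 1 ≤ a ^ 2 + x ^ 2 := by nlinarith [sq_nonneg x]
      have g2 : 1 ≤ a ^ 2 + τ₁ ^ 2 := by nlinarith [sq_nonneg τ₁]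
      nlinarith)
    rw [← e] at this
    exact this

theorem hasDerivAt_artanh {x : ℝ} (hx : x ∈ Set.Ioo (-1 : ℝ) 1) :
    HasDerivAt Real.artanh (1 / (1 - x ^ 2)) x := by
  have h1 : (0 : ℝ) < 1 + x := by linarith [hx.1]
  have h2 : (0 : ℝ) < 1 - x := by linarith [hx.2]
  have hd := ((((hasDerivAt_id x).const_add 1).div ((hasDerivAt_id x).const_sub 1)
    h2.ne').log (by simp only [id, Pi.div_apply]; positivity)).const_mul (1 / 2)
  have hev : Real.artanh =ᶠ[𝓝 x] fun x => 1 / 2 * Real.log ((1 + x) / (1 - x)) := by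
    filter_upwards [Ioo_mem_nhds hx.1 hx.2] with y hy
    exact Real.artanh_eq_half_log ⟨hy.1.le, hy.2.le⟩
  refine (HasDerivAt.congr_of_eventuallyEq ?_ hev)
  refine hd.congr_deriv ?_
  simp only [id, Pi.div_apply]
  have h3 : 1 - x ^ 2 = (1 + x) * (1 - x) := by ring
  rw [h3]
  field_simp
  ring

theorem hyperbolic_line {a τ₁ τ₂ t : ℝ} (ha : 0 < a) (h₁ : τ₁ / a ∈ Set.Ioo (-1 : ℝ) 1)
    (h₂ : τ₂ / a ∈ Set.Ioo (-1 : ℝ) 1) (hτ : τ₁ ≤ τ₂) (ht0 : 0 ≤ t)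
    (h : Real.cosh t * (√(a ^ 2 - τ₁ ^ 2) * √(a ^ 2 - τ₂ ^ 2)) = a ^ 2 - τ₁ * τ₂) :
    t = Real.artanh (τ₂ / a) - Real.artanh (τ₁ / a) := by
  have hle : Real.artanh (τ₁ / a) ≤ Real.artanh (τ₂ / a) :=
    Real.artanh_le_artanh h₁.1 h₂.2 (by gcongr)
  refine Real.cosh_injOn ht0 (by simpa using hle) ?_
  have e₁ := sqrt_one_add_div_sq (K := -1) (τ := τ₁) ha
  have e₂ := sqrt_one_add_div_sq (K := -1) (τ := τ₂) ha
  simp only [neg_mul, one_mul, ← sub_eq_add_neg] at e₁ e₂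
  rw [e₁, e₂] at h
  have p₁ : 0 < √(1 - (τ₁ / a) ^ 2) := Real.sqrt_pos.2 (by nlinarith [h₁.1, h₁.2])
  have p₂ : 0 < √(1 - (τ₂ / a) ^ 2) := Real.sqrt_pos.2 (by nlinarith [h₂.1, h₂.2])
  rw [Real.cosh_sub, Real.cosh_artanh h₁, Real.cosh_artanh h₂, Real.sinh_artanh h₁,
    Real.sinh_artanh h₂]
  have : Real.cosh t =
      (a ^ 2 - τ₁ * τ₂) / (a * √(1 - (τ₁ / a) ^ 2) * (a * √(1 - (τ₂ / a) ^ 2))) := by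
    rw [eq_div_iff (by positivity), h]
  rw [this]
  field_simp

/-- The derivative a/(a² - x²) of artanh(x/a) is at most 1/m and has Lipschitz constant 2M/m²
relative to τ₁; the bounds at the two ends hold between them because |x| is largest at an end. -/
theorem hyperbolic_line_bounds {a τ₁ τ₂ t m M : ℝ} (ha0 : 0 < a) (ha : a ≤ 1) (hm : 0 < m)
    (h₁ : m ≤ a ^ 2 - τ₁ ^ 2) (h₂ : m ≤ a ^ 2 - τ₂ ^ 2) (hM₁ : |τ₁| ≤ M) (hM₂ : |τ₂| ≤ M)
    (hτ : τ₁ ≤ τ₂) (ht0 : 0 ≤ t)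
    (h : Real.cosh t * (√(a ^ 2 - τ₁ ^ 2) * √(a ^ 2 - τ₂ ^ 2)) = a ^ 2 - τ₁ * τ₂) :
    t ≤ m⁻¹ * (τ₂ - τ₁) ∧
      |t - a / (a ^ 2 - τ₁ ^ 2) * (τ₂ - τ₁)| ≤ M * m⁻¹ ^ 2 * (τ₂ - τ₁) ^ 2 := by
  have hIoo : ∀ x, 0 < a ^ 2 - x ^ 2 → x / a ∈ Set.Ioo (-1 : ℝ) 1 := fun x hx => by
    have h3 := abs_lt_of_sq_lt_sq' (by linarith : x ^ 2 < a ^ 2) ha0.le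
    constructor
    · rw [lt_div_iff₀ ha0]; linarith
    · rw [div_lt_one ha0]; linarith
  have e := hyperbolic_line ha0 (hIoo _ (by linarith)) (hIoo _ (by linarith)) hτ ht0 h
  have habs : ∀ x, τ₁ ≤ x → x ≤ τ₂ → |x| ≤ max |τ₁| |τ₂| := fun x h3 h4 => abs_le_max_abs_abs h3 h4
  have hm' : ∀ x, τ₁ ≤ x → x ≤ τ₂ → m ≤ a ^ 2 - x ^ 2 := fun x h3 h4 => by
    have h5 := habs x h3 h4
    rcases le_max_iff.1 h5 with h6 | h6
    · have := sq_le_sq.2 h6; linarith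
    · have := sq_le_sq.2 h6; linarith
  have hM' : ∀ x, τ₁ ≤ x → x ≤ τ₂ → |x| ≤ M := fun x h3 h4 =>
    (habs x h3 h4).trans (max_le hM₁ hM₂)
  have hd : ∀ x, τ₁ ≤ x → x ≤ τ₂ →
      HasDerivAt (fun x => Real.artanh (x / a)) (a / (a ^ 2 - x ^ 2)) x := fun x h3 h4 => by
    have h5 : 0 < a ^ 2 - x ^ 2 := by linarith [hm' x h3 h4]
    have := (hasDerivAt_artanh (hIoo x h5)).comp x ((hasDerivAt_id x).div_const a)
    refine this.congr_deriv ?_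
    have h6 : 1 - (x / a) ^ 2 = (a ^ 2 - x ^ 2) / a ^ 2 := by field_simp
    rw [h6]
    field_simp
  constructor
  · have := sub_le_mul_of_hasDerivAt (A := m⁻¹) hτ hd (fun x h3 h4 => by
      have h5 := hm' x h3 h4
      rw [div_le_iff₀ (by linarith), ← div_eq_inv_mul, le_div_iff₀ hm]
      nlinarith)
    linarith
  · have := abs_taylor_two_le (B := 2 * M * m⁻¹ ^ 2) hτ hd (fun x h3 h4 => by
      have p1 := hm' x h3 h4
      have q1 : a ^ 2 - x ^ 2 ≠ 0 := by linarith
      have q2 : a ^ 2 - τ₁ ^ 2 ≠ 0 := by linarith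
      have e2 : a / (a ^ 2 - x ^ 2) - a / (a ^ 2 - τ₁ ^ 2) =
          (a * (x + τ₁)) / ((a ^ 2 - x ^ 2) * (a ^ 2 - τ₁ ^ 2)) * (x - τ₁) := by
        field_simp
        ring
      rw [e2, abs_mul, abs_of_nonneg (sub_nonneg.2 h3)]
      refine mul_le_mul_of_nonneg_right ?_ (sub_nonneg.2 h3)
      have hp : m ^ 2 ≤ (a ^ 2 - x ^ 2) * (a ^ 2 - τ₁ ^ 2) := by nlinarith
      have hm2 : 0 < m ^ 2 := by positivity
      rw [abs_div, abs_of_pos (by linarith : 0 < (a ^ 2 - x ^ 2) * (a ^ 2 - τ₁ ^ 2)), inv_pow,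
        ← div_eq_mul_inv]
      have hnum : |a * (x + τ₁)| ≤ 2 * M := by
        rw [abs_mul, abs_of_pos ha0]
        have := abs_add_le x τ₁
        have := hM' x h3 h4
        nlinarith [abs_nonneg (x + τ₁)]
      exact div_le_div₀ (by linarith [abs_nonneg τ₁]) hnum hm2 hp)
    rw [← e] at this
    refine this.trans (le_of_eq ?_)
    ring

/-! ### The geodesic map in coordinates -/

theorem form_affine {K : ℝ} {x₀ : Amb d} {e : Fin d → Amb d} (hK : K = 1 ∨ K = -1)
    (hx₀ : x₀ ∈ space K d) (he : IsFrame K x₀ e) (z w : EuclideanSpace ℝ (Fin d)) :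
    form K (x₀ + ∑ i, z i • e i) (x₀ + ∑ i, w i • e i) = 1 + K * inner ℝ z w := by
  have h1 := form_center hx₀ he 1 z
  have h2 := fun i => metric_frame he 1 z i
  rw [one_smul] at h1
  simp only [one_smul] at h2
  rw [form_add, form_comm K _ x₀, h1, form_sum, PiLp.inner_apply, Finset.mul_sum]
  congr 1
  refine Finset.sum_congr rfl fun i _ => ?_
  have h3 := h2 i
  rw [metric] at h3
  rw [form_comm, RCLike.inner_apply, conj_trivial, ← h3]
  rcases hK with rfl | rfl <;> ring

theorem form_geoMapInv {K : ℝ} {x₀ : Amb d} {e : Fin d → Amb d} (hK : K = 1 ∨ K = -1)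
    (hx₀ : x₀ ∈ space K d) (he : IsFrame K x₀ e) (z w : EuclideanSpace ℝ (Fin d)) :
    form K (geoMapInv K x₀ e z) (geoMapInv K x₀ e w) =
      (1 + K * inner ℝ z w) / (√(1 + K * ‖z‖ ^ 2) * √(1 + K * ‖w‖ ^ 2)) := by
  rw [geoMapInv, geoMapInv, form_smul, form_smul_left, form_affine hK hx₀ he]
  field_simp

theorem form_center_geoMapInv {K : ℝ} {x₀ : Amb d} {e : Fin d → Amb d}
    (hx₀ : x₀ ∈ space K d) (he : IsFrame K x₀ e) (z : EuclideanSpace ℝ (Fin d)) :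
    form K x₀ (geoMapInv K x₀ e z) = (√(1 + K * ‖z‖ ^ 2))⁻¹ := by
  have h1 := form_center hx₀ he 1 z
  rw [one_smul] at h1
  rw [geoMapInv, form_smul, h1, mul_one]

theorem geoMapInv_mem_space {K : ℝ} {x₀ : Amb d} {e : Fin d → Amb d} (hK : K = 1 ∨ K = -1)
    (hx₀ : x₀ ∈ space K d) (he : IsFrame K x₀ e) {z : EuclideanSpace ℝ (Fin d)}
    (hz : 0 < 1 + K * ‖z‖ ^ 2) : geoMapInv K x₀ e z ∈ space K d := by
  refine mem_space_of_form hx₀ ?_ fun _ => ?_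
  · rw [form_geoMapInv hK hx₀ he, real_inner_self_eq_norm_sq, Real.mul_self_sqrt hz.le,
      div_self hz.ne']
  · rw [form_center_geoMapInv hx₀ he]
    exact inv_pos.2 (Real.sqrt_pos.2 hz)

/-- Before normalisation the inverse map is affine in w, and g annihilates its value at z, so only
the increment w - z survives. -/
theorem metric_geoMapInv {K : ℝ} {x₀ : Amb d} {e : Fin d → Amb d}
    {z : EuclideanSpace ℝ (Fin d)} (hz : 0 < 1 + K * ‖z‖ ^ 2) {g : Amb d}
    (hg : form K (geoMapInv K x₀ e z) g = 0) (w : EuclideanSpace ℝ (Fin d)) :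
    metric K g (geoMapInv K x₀ e w) =
      inner ℝ (WithLp.toLp 2 fun i => metric K g (e i) : EuclideanSpace ℝ (Fin d)) (w - z) /
        √(1 + K * ‖w‖ ^ 2) := by
  have h1 : ∀ y : EuclideanSpace ℝ (Fin d), K * form K g (x₀ + ∑ i, y i • e i) =
      K * form K g x₀ +
        inner ℝ (WithLp.toLp 2 fun i => metric K g (e i) : EuclideanSpace ℝ (Fin d)) y := by
    intro y
    rw [form_add, form_sum, PiLp.inner_apply, mul_add, Finset.mul_sum]
    congr 1
    refine Finset.sum_congr rfl fun i _ => ?_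
    simp only [RCLike.inner_apply, conj_trivial, metric]
    ring
  have h2 : K * form K g (x₀ + ∑ i, z i • e i) = 0 := by
    rw [geoMapInv, form_smul_left, mul_eq_zero] at hg
    rcases hg with h | h
    · exact absurd h (inv_pos.2 (Real.sqrt_pos.2 hz)).ne'
    · rw [form_comm, h, mul_zero]
  have h3 := h1 w
  rw [h1 z] at h2
  rw [metric, geoMapInv, form_smul, inner_sub_right]
  rw [div_eq_inv_mul, mul_left_comm, h3]
  congr 1
  linarith

/-- Coordinates along the line through two points of `ℝ^d`. -/
theorem exists_line_coord {K : ℝ} (hK : K = 1 ∨ K = -1) {z w : EuclideanSpace ℝ (Fin d)}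
    (hzw : z ≠ w) (hz : 0 < 1 + K * ‖z‖ ^ 2) :
    ∃ a τ₁ τ₂ : ℝ, 0 < a ∧ (K = 1 → 1 ≤ a) ∧ (K = -1 → a ≤ 1) ∧ τ₂ - τ₁ = ‖w - z‖ ∧
      1 + K * ‖z‖ ^ 2 = a ^ 2 + K * τ₁ ^ 2 ∧ 1 + K * ‖w‖ ^ 2 = a ^ 2 + K * τ₂ ^ 2 ∧
      1 + K * inner ℝ z w = a ^ 2 + K * (τ₁ * τ₂) ∧ |τ₁| ≤ ‖z‖ ∧ |τ₂| ≤ ‖w‖ := by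
  have hl : 0 < ‖w - z‖ := norm_pos_iff.2 (sub_ne_zero.2 hzw.symm)
  set l := ‖w - z‖ with hld
  set u := l⁻¹ • (w - z) with hu
  have hun : ‖u‖ = 1 := by
    rw [hu, norm_smul, norm_inv, Real.norm_of_nonneg hl.le, ← hld, inv_mul_cancel₀ hl.ne']
  have hw : w = z + l • u := by
    rw [hu, smul_smul, mul_inv_cancel₀ hl.ne', one_smul]; abel
  set τ := inner ℝ z u with hτ
  have huu : inner ℝ u u = 1 := by rw [real_inner_self_eq_norm_sq, hun, one_pow]
  have hτ2 : inner ℝ w u = τ + l := by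
    rw [hw, inner_add_left, real_inner_smul_left, huu, mul_one]
  have hτ1 : |τ| ≤ ‖z‖ := by
    have := abs_real_inner_le_norm z u
    rwa [hun, mul_one] at this
  have hτ2' : |τ + l| ≤ ‖w‖ := by
    have := abs_real_inner_le_norm w u
    rwa [hun, mul_one, hτ2] at this
  have hww : ‖w‖ ^ 2 = ‖z‖ ^ 2 + 2 * l * τ + l ^ 2 := by
    rw [hw, norm_add_sq_real, real_inner_smul_right, norm_smul, hun, Real.norm_of_nonneg hl.le]
    ring
  have hzwi : inner ℝ z w = ‖z‖ ^ 2 + l * τ := by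
    rw [hw, inner_add_right, real_inner_smul_right, real_inner_self_eq_norm_sq]
  have hsq : τ ^ 2 ≤ ‖z‖ ^ 2 := by
    rw [← sq_abs]; gcongr
  have ha : 0 < 1 + K * (‖z‖ ^ 2 - τ ^ 2) := by
    rcases hK with rfl | rfl
    · linarith
    · nlinarith [sq_nonneg τ]
  have hsa := Real.sq_sqrt ha.le
  -- Here ‖z‖² - τ² is the squared distance from the origin to the line, and τ is measured from the
  -- foot of the perpendicular.
  refine ⟨√(1 + K * (‖z‖ ^ 2 - τ ^ 2)), τ, τ + l, Real.sqrt_pos.2 ha, ?_, ?_, by ring, ?_, ?_, ?_,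
    hτ1, hτ2'⟩
  · rintro rfl
    exact Real.one_le_sqrt.2 (by linarith)
  · rintro rfl
    exact Real.sqrt_le_one.2 (by linarith)
  · rw [hsa]; ring
  · rw [hsa, hww]; ring
  · rw [hsa, hzwi]; ring

/-- First and second order comparison of geodesic and Euclidean distance. -/
theorem rdist_geoMapInv_bounds {K : ℝ} {x₀ : Amb d} {e : Fin d → Amb d} (hK : K = 1 ∨ K = -1)
    (hx₀ : x₀ ∈ space K d) (he : IsFrame K x₀ e) {z w : EuclideanSpace ℝ (Fin d)}
    (hzw : z ≠ w) {m M : ℝ} (hm : 0 < m) (hM : K = -1 → ‖z‖ ≤ M ∧ ‖w‖ ≤ M)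
    (hz : m ≤ 1 + K * ‖z‖ ^ 2) (hw : m ≤ 1 + K * ‖w‖ ^ 2) :
    0 < rdist K (geoMapInv K x₀ e z) (geoMapInv K x₀ e w) ∧
    rdist K (geoMapInv K x₀ e z) (geoMapInv K x₀ e w) ≤ (if K = 1 then 1 else m⁻¹) * ‖w - z‖ ∧
    |rdist K (geoMapInv K x₀ e z) (geoMapInv K x₀ e w) -
      √(1 + K * ‖w‖ ^ 2) / √(1 + K * ‖z‖ ^ 2) *
        sinK K (rdist K (geoMapInv K x₀ e z) (geoMapInv K x₀ e w))| ≤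
      (if K = 1 then 1 / 2 else M * m⁻¹ ^ 2) * ‖w - z‖ ^ 2 := by
  have hz0 : 0 < 1 + K * ‖z‖ ^ 2 := by linarith
  have hw0 : 0 < 1 + K * ‖w‖ ^ 2 := by linarith
  have hzs := geoMapInv_mem_space hK hx₀ he hz0
  have hws := geoMapInv_mem_space hK hx₀ he hw0
  have hcos := cosK_rdist hK hzs hws
  have hd0 := rdist_nonneg hK hzs hws
  set t := rdist K (geoMapInv K x₀ e z) (geoMapInv K x₀ e w) with ht
  have htpi : K = 1 → t ≤ Real.pi := by rintro rfl; exact rdist_le_pi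
  have hl : 0 < ‖w - z‖ := norm_pos_iff.2 (sub_ne_zero.2 hzw.symm)
  obtain ⟨a, τ₁, τ₂, ha0, ha1, ha2, hτ, e1, e2, e3, b1, b2⟩ := exists_line_coord hK hzw hz0
  have hsz : 0 < √(1 + K * ‖z‖ ^ 2) := Real.sqrt_pos.2 hz0
  have hsw : 0 < √(1 + K * ‖w‖ ^ 2) := Real.sqrt_pos.2 hw0
  rw [form_geoMapInv hK hx₀ he, eq_div_iff (by positivity), e3] at hcos
  have qz := Real.sq_sqrt hz0.le
  have qw := Real.sq_sqrt hw0.le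
  set A := √(1 + K * ‖z‖ ^ 2) with hA
  set B := √(1 + K * ‖w‖ ^ 2) with hB
  have hsin0 : 0 ≤ sinK K t := by
    rcases hd0.eq_or_lt with h | h
    · rw [← h, sinK_zero]
    · rcases hK with rfl | rfl
      · rw [sinK_one]; exact Real.sin_nonneg_of_nonneg_of_le_pi hd0 (htpi rfl)
      · exact (sinK_pos h (fun h => absurd h neg_one_ne_one)).le
  have hsin : sinK K t * (A * B) = a * ‖w - z‖ := by
    have hsq : (sinK K t * (A * B)) ^ 2 = (a * ‖w - z‖) ^ 2 := by
      have h1 := cosK_sq_add hK t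
      have h2 := mul_self_eq_one hK
      have h3 : sinK K t ^ 2 = K * (1 - cosK K t ^ 2) := by
        linear_combination (-(sinK K t ^ 2)) * h2 + K * h1
      rw [mul_pow, h3]
      have h4 : K * (1 - cosK K t ^ 2) * (A * B) ^ 2 =
          K * (A ^ 2 * B ^ 2 - (cosK K t * (A * B)) ^ 2) := by ring
      rw [h4, hcos, qz, qw, e1, e2, ← hτ]
      linear_combination (a ^ 2 * (τ₂ - τ₁) ^ 2) * h2
    exact (pow_left_inj₀ (by positivity) (by positivity) two_ne_zero).1 hsq
  have hsinne : sinK K t ≠ 0 := fun h => by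
    rw [h, zero_mul] at hsin
    have : 0 < a * ‖w - z‖ := by positivity
    linarith
  -- The right side is the derivative of arctan(τ/a) or artanh(τ/a) at τ₁ times the increment of τ.
  have hratio : B / A * sinK K t = a / (a ^ 2 + K * τ₁ ^ 2) * ‖w - z‖ := by
    rw [← e1, ← qz]
    field_simp
    linarith
  refine ⟨lt_of_le_of_ne hd0 fun h => hsinne (by rw [← h, sinK_zero]), ?_⟩
  rw [hratio, ← hτ]
  have hτle : τ₁ ≤ τ₂ := by linarith
  rcases hK with rfl | rfl
  · simp only [if_true, one_mul, cosK_one] at *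
    refine spherical_line_bounds (ha1 trivial) hτle hd0 (htpi trivial) ?_
    rw [← e1, ← e2, ← hA, ← hB]; exact hcos
  · simp only [if_neg neg_one_ne_one, cosK_neg_one, neg_mul, one_mul, ← sub_eq_add_neg] at *
    have hM' := hM trivial
    refine hyperbolic_line_bounds ha0 (ha2 trivial) hm (by linarith) (by linarith)
      (b1.trans hM'.1) (b2.trans hM'.2) hτle hd0 ?_
    rw [← e1, ← e2, ← hA, ← hB]; exact hcos

/-! ### Differentiability of F ∘ h⁻¹ -/

theorem rdist_self {K : ℝ} {x : Amb d} (hx : x ∈ space K d) : rdist K x x = 0 :=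
  rdist_eq_of_form le_rfl (fun _ => Real.pi_pos.le) (by rw [hx.1, cosK_zero])

theorem continuousAt_geoMapInv {K : ℝ} {x₀ : Amb d} {e : Fin d → Amb d}
    {z : EuclideanSpace ℝ (Fin d)} (hz : 0 < 1 + K * ‖z‖ ^ 2) :
    ContinuousAt (geoMapInv K x₀ e) z := by
  have h1 : Continuous fun w : EuclideanSpace ℝ (Fin d) => √(1 + K * ‖w‖ ^ 2) := by fun_prop
  have h2 : Continuous fun w : EuclideanSpace ℝ (Fin d) => x₀ + ∑ i, w i • e i := by fun_prop
  exact (h1.continuousAt.inv₀ (Real.sqrt_pos.2 hz).ne').smul h2.continuousAt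

theorem eventually_half_le {K : ℝ} {z : EuclideanSpace ℝ (Fin d)} (hz : 0 < 1 + K * ‖z‖ ^ 2) :
    ∀ᶠ w in 𝓝 z, (1 + K * ‖z‖ ^ 2) / 2 ≤ 1 + K * ‖w‖ ^ 2 := by
  have h1 : Continuous fun w : EuclideanSpace ℝ (Fin d) => 1 + K * ‖w‖ ^ 2 := by fun_prop
  exact h1.continuousAt.eventually (le_mem_nhds (half_lt_self hz))

theorem rdist_geoMapInv_isBigO {K : ℝ} {x₀ : Amb d} {e : Fin d → Amb d} (hK : K = 1 ∨ K = -1)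
    (hx₀ : x₀ ∈ space K d) (he : IsFrame K x₀ e) {z : EuclideanSpace ℝ (Fin d)}
    (hz : 0 < 1 + K * ‖z‖ ^ 2) :
    (fun w => rdist K (geoMapInv K x₀ e z) (geoMapInv K x₀ e w)) =O[𝓝 z] fun w => w - z := by
  have hm : 0 < (1 + K * ‖z‖ ^ 2) / 2 := half_pos hz
  refine IsBigO.of_bound (if K = 1 then 1 else ((1 + K * ‖z‖ ^ 2) / 2)⁻¹) ?_
  filter_upwards [eventually_half_le hz] with w hw
  rcases eq_or_ne z w with rfl | hzw
  · rw [rdist_self (geoMapInv_mem_space hK hx₀ he hz)]; simp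
  · obtain ⟨h1, h2, -⟩ := rdist_geoMapInv_bounds hK hx₀ he hzw hm
      (fun _ => ⟨le_max_left ‖z‖ ‖w‖, le_max_right ‖z‖ ‖w‖⟩) (half_le_self hz.le) hw
    rwa [Real.norm_of_nonneg h1.le]

theorem tendsto_rdist_geoMapInv {K : ℝ} {x₀ : Amb d} {e : Fin d → Amb d} (hK : K = 1 ∨ K = -1)
    (hx₀ : x₀ ∈ space K d) (he : IsFrame K x₀ e) {z : EuclideanSpace ℝ (Fin d)}
    (hz : 0 < 1 + K * ‖z‖ ^ 2) :
    Filter.Tendsto (fun w => rdist K (geoMapInv K x₀ e z) (geoMapInv K x₀ e w)) (𝓝 z) (𝓝 0) := by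
  refine (rdist_geoMapInv_isBigO hK hx₀ he hz).trans_tendsto ?_
  have : Continuous fun w : EuclideanSpace ℝ (Fin d) => w - z := by fun_prop
  simpa using this.tendsto z

/-- The value 1 fills the removable singularity at t = 0, where the quotient itself would be 0/0 =
0. -/
theorem continuousAt_div_sinK {K : ℝ} :
    ContinuousAt (Function.update (fun t => t / sinK K t) 0 1) 0 := by
  rw [continuousAt_update_same]
  have h := hasDerivAt_iff_tendsto_slope.1 (hasDerivAt_sinK (K := K) 0)
  rw [cosK_zero] at h
  have h2 := h.inv₀ one_ne_zero
  rw [inv_one] at h2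
  refine h2.congr fun t => ?_
  rw [slope_def_field, sinK_zero, sub_zero, sub_zero, inv_div]

/-- The gradient of `F ∘ h⁻¹` in terms of the Riemannian gradient of `F`. -/
theorem HasRGradAt.hasGradientAt {K : ℝ} {x₀ : Amb d} {e : Fin d → Amb d} (hK : K = 1 ∨ K = -1)
    (hx₀ : x₀ ∈ space K d) (he : IsFrame K x₀ e) {z : EuclideanSpace ℝ (Fin d)}
    (hz : 0 < 1 + K * ‖z‖ ^ 2) {F : Amb d → ℝ} {g : Amb d}
    (hF : HasRGradAt K F g (geoMapInv K x₀ e z)) :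
    HasGradientAt (F ∘ geoMapInv K x₀ e)
      ((√(1 + K * ‖z‖ ^ 2))⁻¹ • (WithLp.toLp 2 fun i => metric K g (e i))) z := by
  obtain ⟨hg, ho⟩ := hF
  have hg' : form K (geoMapInv K x₀ e z) g = 0 := hg
  set gh : EuclideanSpace ℝ (Fin d) := WithLp.toLp 2 fun i => metric K g (e i) with hgh
  have htend : Filter.Tendsto (geoMapInv K x₀ e) (𝓝 z)
      (𝓝[space K d] (geoMapInv K x₀ e z)) := by
    refine tendsto_nhdsWithin_iff.2 ⟨continuousAt_geoMapInv hz, ?_⟩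
    filter_upwards [eventually_half_le hz] with w hw
    exact geoMapInv_mem_space hK hx₀ he (by linarith)
  have hO := rdist_geoMapInv_isBigO hK hx₀ he hz
  have h1 := (ho.comp_tendsto htend).trans_isBigO hO
  have htd := tendsto_rdist_geoMapInv hK hx₀ he hz
  set q := Function.update (fun t => t / sinK K t) 0 1 with hq
  have hqt : Filter.Tendsto (fun w => q (rdist K (geoMapInv K x₀ e z) (geoMapInv K x₀ e w)))
      (𝓝 z) (𝓝 1) := by
    have := (continuousAt_div_sinK (K := K)).tendsto.comp htd
    rw [Function.update_self] at this
    exact this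
  have hsq : Continuous fun w : EuclideanSpace ℝ (Fin d) => √(1 + K * ‖w‖ ^ 2) := by fun_prop
  have hcoef : Filter.Tendsto (fun w =>
      q (rdist K (geoMapInv K x₀ e z) (geoMapInv K x₀ e w)) / √(1 + K * ‖w‖ ^ 2) -
        (√(1 + K * ‖z‖ ^ 2))⁻¹) (𝓝 z) (𝓝 0) := by
    have := (hqt.div (hsq.tendsto z) (Real.sqrt_pos.2 hz).ne').sub_const (√(1 + K * ‖z‖ ^ 2))⁻¹
    simpa using this
  have hin : (fun w : EuclideanSpace ℝ (Fin d) => inner ℝ gh (w - z)) =O[𝓝 z] fun w => w - z := by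
    refine IsBigO.of_bound ‖gh‖ (Filter.Eventually.of_forall fun w => ?_)
    exact norm_inner_le_norm _ _
  have h2 : (fun w => metric K g (rlog K (geoMapInv K x₀ e z) (geoMapInv K x₀ e w)) -
      inner ℝ ((√(1 + K * ‖z‖ ^ 2))⁻¹ • gh) (w - z)) =o[𝓝 z] fun w => w - z := by
    have h3 := ((isLittleO_one_iff ℝ).2 hcoef).mul_isBigO hin.norm_right
    simp only [one_mul] at h3
    refine (h3.of_norm_right).congr' ?_ Filter.EventuallyEq.rfl
    filter_upwards [eventually_half_le hz] with w hw
    rw [metric_rlog hg', metric_geoMapInv hz hg', ← hgh, real_inner_smul_left]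
    rcases eq_or_ne z w with rfl | hzw
    · simp
    · obtain ⟨h1, -, -⟩ := rdist_geoMapInv_bounds hK hx₀ he hzw (half_pos hz)
        (fun _ => ⟨le_max_left ‖z‖ ‖w‖, le_max_right ‖z‖ ‖w‖⟩) (half_le_self hz.le) hw
      rw [hq, Function.update_of_ne h1.ne']
      ring
  rw [hasGradientAt_iff_isLittleO]
  refine (h1.add h2).congr_left fun w => ?_
  simp only [Function.comp]
  ring

/-! ### The image of the ball -/

theorem mem_image_geoMap_iff {K : ℝ} {x₀ : Amb d} {e : Fin d → Amb d} (hK : K = 1 ∨ K = -1)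
    (hx₀ : x₀ ∈ space K d) (he : IsFrame K x₀ e) {R : ℝ} (hR : 0 < R)
    (hRK : K = 1 → R < Real.pi / 2) {z : EuclideanSpace ℝ (Fin d)} :
    z ∈ geoMap K x₀ e '' cball K x₀ R ↔
      0 < 1 + K * ‖z‖ ^ 2 ∧ geoMapInv K x₀ e z ∈ cball K x₀ R := by
  constructor
  · rintro ⟨x, hx, rfl⟩
    have hRpi : K = 1 → R ≤ Real.pi := fun h => by linarith [hRK h, Real.pi_pos]
    have hpos : 0 < form K x₀ x := by
      rcases hK with rfl | rfl
      · have h1 := (mem_cball_iff (Or.inl rfl) hx₀ hR.le hRpi hx.1).1 hx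
        have h2 := cosK_pos_of_lt (Or.inl rfl) hR hRK
        linarith
      · linarith [one_le_form hx₀ hx.1]
    have h3 := geoMapInv_geoMap hK hx₀ he x hx.1 hpos
    refine ⟨?_, by rwa [h3]⟩
    by_contra hcon
    push Not at hcon
    -- Outside its domain the inverse map takes the default value 0, which pairs to 0 with x₀.
    rw [geoMapInv, Real.sqrt_eq_zero'.2 hcon, inv_zero, zero_smul] at h3
    rw [← h3, form_zero_right] at hpos
    exact lt_irrefl _ hpos
  · rintro ⟨h1, h2⟩
    exact ⟨_, h2, geoMap_geoMapInv hx₀ he z h1⟩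

/-- The image of a geodesic ball is a Euclidean ball. -/
theorem mem_image_geoMap_iff_norm_sq_le {K : ℝ} {x₀ : Amb d} {e : Fin d → Amb d}
    (hK : K = 1 ∨ K = -1) (hx₀ : x₀ ∈ space K d) (he : IsFrame K x₀ e) {R : ℝ} (hR : 0 < R)
    (hRK : K = 1 → R < Real.pi / 2) {z : EuclideanSpace ℝ (Fin d)} :
    z ∈ geoMap K x₀ e '' cball K x₀ R ↔ ‖z‖ ^ 2 ≤ K * ((cosK K R)⁻¹ ^ 2 - 1) := by
  have hRpi : K = 1 → R ≤ Real.pi := fun h => by linarith [hRK h, Real.pi_pos]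
  have hc := cosK_pos_of_lt hK hR hRK
  have hci : 0 < (cosK K R)⁻¹ := inv_pos.2 hc
  have key : 0 < 1 + K * ‖z‖ ^ 2 → (0 ≤ K * (form K x₀ (geoMapInv K x₀ e z) - cosK K R) ↔
      ‖z‖ ^ 2 ≤ K * ((cosK K R)⁻¹ ^ 2 - 1)) := by
    intro h
    have hs := Real.sqrt_pos.2 h
    rw [form_center_geoMapInv hx₀ he]
    have hsq := Real.sq_sqrt h.le
    generalize √(1 + K * ‖z‖ ^ 2) = s at hs hsq ⊢
    rcases hK with rfl | rfl
    · rw [one_mul, one_mul, sub_nonneg, le_inv_comm₀ hc hs, ← pow_le_pow_iff_left₀ hs.le hci.le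
        two_ne_zero, hsq]
      constructor <;> intro <;> linarith
    · rw [neg_one_mul, neg_one_mul, neg_sub, neg_sub, sub_nonneg, inv_le_comm₀ hs hc,
        ← pow_le_pow_iff_left₀ hci.le hs.le two_ne_zero, hsq]
      constructor <;> intro <;> linarith
  rw [mem_image_geoMap_iff hK hx₀ he hR hRK]
  constructor
  · rintro ⟨h1, h2⟩
    rwa [← key h1, ← mem_cball_iff hK hx₀ hR.le hRpi h2.1]
  · intro h
    have h1 : 0 < 1 + K * ‖z‖ ^ 2 := by
      rcases hK with rfl | rfl
      · positivity
      · have : 0 < (cosK (-1) R)⁻¹ ^ 2 := by positivity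
        linarith
    refine ⟨h1, ?_⟩
    rw [mem_cball_iff hK hx₀ hR.le hRpi (geoMapInv_mem_space hK hx₀ he h1), key h1]
    exact h

/-! ### Numerical constants and Euclidean smoothness -/

theorem sqrt_forty_four_ge : 6.63 ≤ √44 := Real.le_sqrt_of_sq_le (by norm_num)

theorem sqrt_two_le : √2 ≤ 1.415 := Real.sqrt_le_iff.2 (by norm_num)

theorem tanh_sq (R : ℝ) : Real.tanh R ^ 2 = 1 - (Real.cosh R)⁻¹ ^ 2 := by
  rw [Real.tanh_eq_sinh_div_cosh, div_pow, Real.sinh_sq]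
  have := (Real.cosh_pos R).ne'
  field_simp

/-- Bounding tanh by 1 is not enough at R = 1, as 1 + 4√2 > √44. Up to 1.04 the bound tanh R ≤ 0.94
suffices; beyond it the growth of max 1 R absorbs the summand 1. -/
theorem one_add_mul_tanh_le {R : ℝ} (hR : 0 < R) :
    1 + 4 * √2 * R * Real.tanh R ≤ √44 * max 1 R := by
  have h44 := sqrt_forty_four_ge
  have h2 := sqrt_two_le
  have ht0 : 0 ≤ Real.tanh R := by
    rw [Real.tanh_eq_sinh_div_cosh]
    exact div_nonneg (Real.sinh_nonneg_iff.2 hR.le) (Real.cosh_pos R).le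
  have hts := tanh_sq R
  have hA : 4 * √2 * R * Real.tanh R ≤ 5.66 * R * Real.tanh R :=
    mul_le_mul_of_nonneg_right (by nlinarith) ht0
  rcases le_total R 1.04 with h | h
  · have hc : Real.cosh R ^ 2 ≤ 7.4 := by
      have h3 := Real.cosh_le_exp_half_sq R
      have h4 : Real.cosh R ≤ Real.exp 1 :=
        h3.trans (Real.exp_le_exp.2 (by nlinarith))
      have h5 := Real.exp_one_lt_d9
      have h6 := Real.cosh_pos R
      nlinarith
    have hi : (1 : ℝ) / 7.4 ≤ (Real.cosh R)⁻¹ ^ 2 := by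
      rw [inv_pow, ← one_div]
      exact one_div_le_one_div_of_le (by have := Real.cosh_pos R; positivity) hc
    have ht : Real.tanh R ≤ 0.94 := by nlinarith
    have h7 : R * Real.tanh R ≤ 1.04 * 0.94 := mul_le_mul h ht ht0 (by norm_num)
    have h8 : 6.63 ≤ √44 * max 1 R :=
      h44.trans (le_mul_of_one_le_right (by positivity) (le_max_left _ _))
    nlinarith
  · have ht : Real.tanh R ≤ 1 := (Real.tanh_lt_one R).le
    have h7 : R * Real.tanh R ≤ R := mul_le_of_le_one_right hR.le ht
    have h8 : 6.63 * R ≤ √44 * max 1 R :=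
      mul_le_mul h44 (le_max_right _ _) hR.le (by positivity)
    nlinarith

theorem one_add_mul_le {R : ℝ} (hR : 0 < R) : 1 + 2 * √2 * R ≤ √44 * max 1 R := by
  have h44 := sqrt_forty_four_ge
  have h2 := sqrt_two_le
  have h3 : 6.63 * max 1 R ≤ √44 * max 1 R :=
    mul_le_mul_of_nonneg_right h44 (by positivity)
  nlinarith [le_max_left 1 R, le_max_right 1 R]

/-- Euclidean smoothness of `F ∘ h⁻¹`. -/
theorem IsSmoothOn.abs_comp_geoMapInv_le {K : ℝ} (hK : K = 1 ∨ K = -1) {x₀ : Amb d}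
    (hx₀ : x₀ ∈ space K d) {e : Fin d → Amb d} (he : IsFrame K x₀ e) {R : ℝ} (hR : 0 < R)
    (hRK : K = 1 → R < Real.pi / 2) {F : Amb d → ℝ}
    {G : Amb d → Amb d} {L : ℝ} (hL : 0 ≤ L) (hF : IsSmoothOn K (cball K x₀ R) F G L)
    (hG : ∀ x ∈ cball K x₀ R, form K x (G x) = 0) {p : Amb d} (hp : p ∈ cball K x₀ R)
    (hGp : G p = 0) {z w : EuclideanSpace ℝ (Fin d)} (hz : z ∈ geoMap K x₀ e '' cball K x₀ R)
    (hw : w ∈ geoMap K x₀ e '' cball K x₀ R) :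
    |F (geoMapInv K x₀ e w) - F (geoMapInv K x₀ e z) -
      inner ℝ ((√(1 + K * ‖z‖ ^ 2))⁻¹ •
        (WithLp.toLp 2 fun i => metric K (G (geoMapInv K x₀ e z)) (e i) :
          EuclideanSpace ℝ (Fin d))) (w - z)| ≤
      (√44 * L * max 1 R * (if K = 1 then 1 else Real.cosh R ^ 4)) / 2 * ‖w - z‖ ^ 2 := by
  rcases eq_or_ne z w with rfl | hzw
  · simp
  have hzn := (mem_image_geoMap_iff_norm_sq_le hK hx₀ he hR hRK).1 hz
  have hwn := (mem_image_geoMap_iff_norm_sq_le hK hx₀ he hR hRK).1 hw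
  obtain ⟨hz0, hx⟩ := (mem_image_geoMap_iff hK hx₀ he hR hRK).1 hz
  obtain ⟨hw0, hy⟩ := (mem_image_geoMap_iff hK hx₀ he hR hRK).1 hw
  have hch := Real.cosh_pos R
  have hth : 0 ≤ Real.tanh R := by
    rw [Real.tanh_eq_sinh_div_cosh]
    exact div_nonneg (Real.sinh_nonneg_iff.2 hR.le) hch.le
  -- m bounds 1 + K|z|² from below on the image; for K = -1, M = tanh R is the Euclidean radius of
  -- the image. M plays no role for K = 1.
  obtain ⟨t0, t1, t2⟩ := rdist_geoMapInv_bounds hK hx₀ he hzw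
    (m := if K = 1 then 1 else (Real.cosh R)⁻¹ ^ 2) (M := Real.tanh R)
    (by split_ifs <;> positivity)
    (by
      rintro rfl
      rw [cosK_neg_one] at hzn hwn
      have := tanh_sq R
      constructor <;> refine (pow_le_pow_iff_left₀ (norm_nonneg _) hth two_ne_zero).1 ?_ <;> linarith)
    (by
      rcases hK with rfl | rfl
      · rw [if_pos rfl]; nlinarith [sq_nonneg ‖z‖]
      · rw [if_neg neg_one_ne_one]; rw [cosK_neg_one] at hzn; linarith)
    (by
      rcases hK with rfl | rfl
      · rw [if_pos rfl]; nlinarith [sq_nonneg ‖w‖]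
      · rw [if_neg neg_one_ne_one]; rw [cosK_neg_one] at hwn; linarith)
  have hs := hF _ hx _ hy
  rw [metric_rlog (hG _ hx)] at hs
  have hin := metric_geoMapInv hz0 (hG _ hx) w
  rw [real_inner_smul_left]
  set gh : EuclideanSpace ℝ (Fin d) :=
    WithLp.toLp 2 fun i => metric K (G (geoMapInv K x₀ e z)) (e i) with hgh
  set x := geoMapInv K x₀ e z with hxd
  set y := geoMapInv K x₀ e w with hyd
  have hD2 : rdist K x y ≤ 2 * R := by
    refine (rdist_triangle hK hx₀ hx.1 hy.1 fun h => ?_).trans (by linarith [hx.2, hy.2])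
    linarith [hx.2, hy.2, hRK h]
  have hDK : K = 1 → rdist K x y < Real.pi := fun h => by linarith [hRK h]
  obtain ⟨v, hv, hvy⟩ := exists_geo hK hx.1 hy.1 t0 hDK
  set t := rdist K x y with ht
  have hk := hF.abs_metric_le hK hx₀ hR hRK hL hG hp hGp hx hv t0 hDK (by rwa [hvy])
  have hsin := sinK_pos t0 hDK
  have hmy : metric K (G x) y = sinK K t * metric K (G x) v := by
    rw [← hvy, metric, form_geo, form_comm K _ x, hG x hx, metric]; ring
  set k := metric K (G x) v with hkd
  have hsz := Real.sqrt_pos.2 hz0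
  have hsw := Real.sqrt_pos.2 hw0
  have e1 : inner ℝ gh (w - z) = √(1 + K * ‖w‖ ^ 2) * (sinK K t * k) := by
    rw [← hmy, hin]; field_simp
  have e2 : t / sinK K t * metric K (G x) y = t * k := by
    rw [hmy]; field_simp
  rw [e1]
  rw [e2] at hs
  -- Riemannian remainder plus k times the Taylor remainder of the distance along the line.
  have hsplit : F y - F x - (√(1 + K * ‖z‖ ^ 2))⁻¹ * (√(1 + K * ‖w‖ ^ 2) * (sinK K t * k)) =
      (F y - F x - t * k) +
        k * (t - √(1 + K * ‖w‖ ^ 2) / √(1 + K * ‖z‖ ^ 2) * sinK K t) := by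
    field_simp; ring
  rw [hsplit]
  refine (abs_add_le _ _).trans ?_
  rw [abs_mul]
  have hkt := mul_le_mul hk t2 (abs_nonneg _) (by positivity)
  have htt := mul_le_mul_of_nonneg_left (pow_le_pow_left₀ t0.le t1 2) (by positivity : 0 ≤ L / 2)
  refine (add_le_add (hs.trans htt) hkt).trans ?_
  -- The total is (L/2)|w - z|² times 1 + 2√2 R for K = 1, and times cosh⁴ R (1 + 4√2 R tanh R) for
  -- K = -1.
  rcases hK with rfl | rfl
  · simp only [if_true]
    have := mul_le_mul_of_nonneg_right (one_add_mul_le hR)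
      (by positivity : 0 ≤ L / 2 * ‖w - z‖ ^ 2)
    linarith
  · simp only [if_neg neg_one_ne_one, inv_pow, inv_inv]
    have := mul_le_mul_of_nonneg_right (one_add_mul_tanh_le hR)
      (by positivity : 0 ≤ L / 2 * Real.cosh R ^ 4 * ‖w - z‖ ^ 2)
    linarith

/-! ### From increments of the gradient to the norm of the Hessian -/

section Hessian

variable {E : Type*} [NormedAddCommGroup E] [InnerProductSpace ℝ E]

theorem opNorm_le_of_symmetric {H : E →L[ℝ] E} {C : ℝ} (hC : 0 ≤ C)
    (hsymm : ∀ x y, inner ℝ (H x) y = inner ℝ (H y) x)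
    (hq : ∀ v, |inner ℝ (H v) v| ≤ C * ‖v‖ ^ 2) : ‖H‖ ≤ C := by
  refine H.opNorm_le_bound hC fun x => ?_
  rcases eq_or_ne (H x) 0 with h0 | h0
  · rw [h0, norm_zero]; positivity
  rcases eq_or_ne x 0 with rfl | hx
  · simp
  have hn : 0 < ‖H x‖ := norm_pos_iff.2 h0
  have hxn : 0 < ‖x‖ := norm_pos_iff.2 hx
  -- Polarisation with y parallel to H x and as long as x; the parallelogram law then sums the two
  -- quadratic bounds.
  set y := (‖x‖ / ‖H x‖) • H x with hy
  have hyn : ‖y‖ = ‖x‖ := by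
    rw [hy, norm_smul, norm_div, norm_norm, norm_norm, div_mul_cancel₀ _ hn.ne']
  have hxy : inner ℝ (H x) y = ‖x‖ * ‖H x‖ := by
    rw [hy, real_inner_smul_right, real_inner_self_eq_norm_sq]; field_simp
  have h1 := (abs_le.1 (hq (x + y))).2
  have h2 := (abs_le.1 (hq (x - y))).1
  have h3 := parallelogram_law_with_norm ℝ x y
  simp only [map_add, map_sub, inner_add_left, inner_add_right, inner_sub_left, inner_sub_right,
    hsymm y x, hxy] at h1 h2
  have h4 : 4 * (‖x‖ * ‖H x‖) ≤ C * (4 * ‖x‖ ^ 2) := by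
    have : C * (‖x + y‖ ^ 2 + ‖x - y‖ ^ 2) = C * (4 * ‖x‖ ^ 2) := by
      congr 1
      rw [hyn] at h3
      linarith
    linarith
  nlinarith

theorem abs_inner_fderiv_le_of_eventually {g : E → E} {H : E →L[ℝ] E} {z v : E} {C : ℝ}
    (hg : HasFDerivAt g H z)
    (h : ∀ᶠ t : ℝ in 𝓝[>] 0, |inner ℝ (g (z + t • v) - g z) (t • v)| ≤ C * ‖t • v‖ ^ 2) :
    |inner ℝ (H v) v| ≤ C * ‖v‖ ^ 2 := by
  have hl : HasDerivAt (fun t : ℝ => z + t • v) v 0 := by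
    have := ((hasDerivAt_id (0 : ℝ)).smul_const v).const_add z
    simpa using this
  have hg' : HasFDerivAt g H (z + (0 : ℝ) • v) := by simpa using hg
  have h1 := hg'.comp_hasDerivAt 0 hl
  have h2 := (hasDerivAt_iff_tendsto_slope.1 h1).mono_left
    (nhdsWithin_mono (0 : ℝ) (fun t (ht : 0 < t) => ht.ne') : 𝓝[>] (0 : ℝ) ≤ 𝓝[≠] 0)
  have h3 := (Filter.Tendsto.inner (𝕜 := ℝ) h2 (tendsto_const_nhds (x := v))).abs
  refine le_of_tendsto h3 ?_
  filter_upwards [h, self_mem_nhdsWithin] with t ht ht0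
  have ht0' : (0 : ℝ) < t := ht0
  rw [slope_def_module, sub_zero, real_inner_smul_left, abs_mul, abs_of_pos (inv_pos.2 ht0')]
  simp only [Function.comp, zero_smul, add_zero]
  rw [real_inner_smul_right, abs_mul, abs_of_pos ht0', norm_smul, Real.norm_of_nonneg ht0'.le,
    mul_pow] at ht
  have : t * |inner ℝ (g (z + t • v) - g z) v| ≤ t * (t * (C * ‖v‖ ^ 2)) := by linarith
  have := le_of_mul_le_mul_left this ht0'
  rw [inv_mul_le_iff₀ ht0']
  exact this

/-- A quadratic bound for increments on a ball bounds the quadratic form of the derivative. -/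
theorem abs_inner_fderiv_le {g : E → E} {H : E →L[ℝ] E} {z : E} {C ρ : ℝ}
    (hρ : 0 < ρ) (hz : ‖z‖ ^ 2 ≤ ρ) (hg : HasFDerivAt g H z)
    (h : ∀ w, ‖w‖ ^ 2 ≤ ρ → |inner ℝ (g w - g z) (w - z)| ≤ C * ‖w - z‖ ^ 2) (v : E) :
    |inner ℝ (H v) v| ≤ C * ‖v‖ ^ 2 := by
  -- At a boundary point only inward directions are testable, but the quadratic form is even.
  wlog hv : inner ℝ z v ≤ 0 generalizing v
  · have := this (-v) (by rw [inner_neg_right]; linarith)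
    simpa using this
  -- Tilting v by -ε z makes even tangential directions point strictly inward; ε → 0 afterwards.
  have key : ∀ ε : ℝ, 0 < ε → |inner ℝ (H (v - ε • z)) (v - ε • z)| ≤ C * ‖v - ε • z‖ ^ 2 := by
    intro ε hε
    refine abs_inner_fderiv_le_of_eventually hg ?_
    -- Membership in the ball reduces to (1 - tε)² ρ + t²‖v‖² ≤ ρ; the second bound on t is this
    -- inequality solved for t.
    have hδ : 0 < min (1 / ε) (2 * ε * ρ / (ε ^ 2 * ρ + ‖v‖ ^ 2)) := by positivity
    filter_upwards [Ioo_mem_nhdsGT hδ] with t ht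
    have ht0 := ht.1
    have ht1 := ht.2.le.trans (min_le_left _ _)
    have ht2 := ht.2.le.trans (min_le_right _ _)
    rw [le_div_iff₀ hε] at ht1
    rw [le_div_iff₀ (by positivity)] at ht2
    have hmem : ‖z + t • (v - ε • z)‖ ^ 2 ≤ ρ := by
      have e : z + t • (v - ε • z) = (1 - t * ε) • z + t • v := by module
      rw [e, norm_add_sq_real, norm_smul, norm_smul, real_inner_smul_left, real_inner_smul_right,
        mul_pow, mul_pow, Real.norm_eq_abs, Real.norm_eq_abs, sq_abs, sq_abs]
      have h1 : (1 - t * ε) * (t * inner ℝ z v) ≤ 0 :=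
        mul_nonpos_of_nonneg_of_nonpos (by linarith) (mul_nonpos_of_nonneg_of_nonpos ht0.le hv)
      have h2 := mul_le_mul_of_nonneg_left hz (sq_nonneg (1 - t * ε))
      have h3 := mul_le_mul_of_nonneg_left ht2 ht0.le
      linarith
    have := h _ hmem
    rwa [add_sub_cancel_left] at this
  have hc : Continuous fun ε : ℝ => v - ε • z := by fun_prop
  have t1 : Filter.Tendsto (fun ε : ℝ => |inner ℝ (H (v - ε • z)) (v - ε • z)|) (𝓝[>] 0)
      (𝓝 |inner ℝ (H (v - (0 : ℝ) • z)) (v - (0 : ℝ) • z)|) :=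
    (((H.continuous.comp hc).inner hc).abs.tendsto 0).mono_left nhdsWithin_le_nhds
  have t2 : Filter.Tendsto (fun ε : ℝ => C * ‖v - ε • z‖ ^ 2) (𝓝[>] 0)
      (𝓝 (C * ‖v - (0 : ℝ) • z‖ ^ 2)) :=
    ((continuous_const.mul (hc.norm.pow 2)).tendsto 0).mono_left nhdsWithin_le_nhds
  rw [zero_smul, sub_zero] at t1 t2
  refine le_of_tendsto_of_tendsto t1 t2 ?_
  filter_upwards [self_mem_nhdsWithin] with ε hε using key ε hε

theorem inner_fderiv_gradient_comm [CompleteSpace E] {f : E → ℝ} {z : E}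
    (hf : ∀ᶠ w in 𝓝 z, DifferentiableAt ℝ f w) (hg : DifferentiableAt ℝ (gradient f) z) (x y : E) :
    inner ℝ (fderiv ℝ (gradient f) z x) y = inner ℝ (fderiv ℝ (gradient f) z y) x := by
  have h1 : ∀ᶠ w in 𝓝 z, HasFDerivAt f (innerSL ℝ (gradient f w)) w := by
    filter_upwards [hf] with w hw
    exact hw.hasGradientAt.hasFDerivAt
  have h2 := (innerSL ℝ (E := E)).hasFDerivAt.comp z hg.hasFDerivAt
  exact second_derivative_symmetric_of_eventually h1 h2 x y

end Hessian

end SpaceForm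

/-! ### The main theorem -/

open SpaceForm in
theorem mainTheorem9 (d : ℕ) (K : ℝ) (hK : K = 1 ∨ K = -1)
    (x₀ : Amb d) (hx₀ : x₀ ∈ space K d) (e : Fin d → Amb d) (he : IsFrame K x₀ e)
    (R R' : ℝ) (hR : 0 < R) (hRK : K = 1 → R < Real.pi / 2) (hR' : R < R')
    (F : Amb d → ℝ) (G : Amb d → Amb d) (hG : ∀ x ∈ oball K x₀ R', HasRGradAt K F (G x) x)
    (L : ℝ) (hL : 0 ≤ L) (hF : IsSmoothOn K (cball K x₀ R) F G L)
    (hcrit : ∃ xs ∈ cball K x₀ R, G xs = 0)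
    (f : EuclideanSpace ℝ (Fin d) → ℝ) (hf : f = F ∘ geoMapInv K x₀ e) :
    (∀ z ∈ geoMap K x₀ e '' cball K x₀ R, DifferentiableAt ℝ f z) ∧
    (∀ z ∈ geoMap K x₀ e '' cball K x₀ R, DifferentiableAt ℝ (gradient f) z →
      ‖fderiv ℝ (gradient f) z‖ ^ 2 ≤
        44 * L ^ 2 * max 1 (R ^ 2) * (if K = 1 then 1 else Real.cosh R ^ 8)) ∧
    (∀ z ∈ geoMap K x₀ e '' cball K x₀ R, ∀ w ∈ geoMap K x₀ e '' cball K x₀ R,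
      |f w - f z - inner ℝ (gradient f z) (w - z)| ≤
        (√44 * L * max 1 R * (if K = 1 then 1 else Real.cosh R ^ 4)) / 2 * ‖w - z‖ ^ 2) := by
  obtain ⟨p, hp, hGp⟩ := hcrit
  have hGt : ∀ x ∈ cball K x₀ R, form K x (G x) = 0 := fun x hx =>
    (hG x ⟨hx.1, hx.2.trans_lt hR'⟩).1
  have hgrad : ∀ z, 0 < 1 + K * ‖z‖ ^ 2 → geoMapInv K x₀ e z ∈ oball K x₀ R' →
      HasGradientAt f ((√(1 + K * ‖z‖ ^ 2))⁻¹ •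
        (WithLp.toLp 2 fun i => metric K (G (geoMapInv K x₀ e z)) (e i))) z := fun z h1 h2 =>
    hf ▸ (hG _ h2).hasGradientAt hK hx₀ he h1
  have hmem : ∀ z ∈ geoMap K x₀ e '' cball K x₀ R, 0 < 1 + K * ‖z‖ ^ 2 ∧
      geoMapInv K x₀ e z ∈ oball K x₀ R' := fun z hz => by
    obtain ⟨h1, h2⟩ := (mem_image_geoMap_iff hK hx₀ he hR hRK).1 hz
    exact ⟨h1, h2.1, h2.2.trans_lt hR'⟩
  have hsmooth : ∀ z ∈ geoMap K x₀ e '' cball K x₀ R, ∀ w ∈ geoMap K x₀ e '' cball K x₀ R,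
      |f w - f z - inner ℝ (gradient f z) (w - z)| ≤
        (√44 * L * max 1 R * (if K = 1 then 1 else Real.cosh R ^ 4)) / 2 * ‖w - z‖ ^ 2 := by
    intro z hz w hw
    rw [(hgrad z (hmem z hz).1 (hmem z hz).2).gradient, hf]
    exact hF.abs_comp_geoMapInv_le hK hx₀ he hR hRK hL hGt hp hGp hz hw
  refine ⟨fun z hz => (hgrad z (hmem z hz).1 (hmem z hz).2).differentiableAt, fun z hz hdiff => ?_,
    hsmooth⟩
  set C := √44 * L * max 1 R * (if K = 1 then 1 else Real.cosh R ^ 4) with hC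
  have hC0 : 0 ≤ C := by
    have := Real.cosh_pos R
    rw [hC]; split_ifs <;> positivity
  have hC2 : C ^ 2 = 44 * L ^ 2 * max 1 (R ^ 2) * (if K = 1 then 1 else Real.cosh R ^ 8) := by
    have h44 : √44 ^ 2 = (44 : ℝ) := Real.sq_sqrt (by norm_num)
    have hmax : max 1 R ^ 2 = max 1 (R ^ 2) := by
      rcases le_total 1 R with h | h
      · rw [max_eq_right h, max_eq_right (by nlinarith)]
      · rw [max_eq_left h, max_eq_left (by nlinarith), one_pow]
    have hif : (if K = 1 then (1 : ℝ) else Real.cosh R ^ 4) ^ 2 =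
        if K = 1 then 1 else Real.cosh R ^ 8 := by
      split_ifs <;> ring
    rw [hC, mul_pow, mul_pow, mul_pow, h44, hmax, hif]
  rw [← hC2]
  refine pow_le_pow_left₀ (norm_nonneg _) ?_ 2
  obtain ⟨hz0, hzR'⟩ := hmem z hz
  -- Symmetry of the Hessian needs f differentiable in a full neighbourhood of z, which the margin
  -- R' - R provides; π / 2 keeps the triangle inequality valid on the sphere.
  have hev : ∀ᶠ w in 𝓝 z, DifferentiableAt ℝ f w := by
    have hzR := ((mem_image_geoMap_iff hK hx₀ he hR hRK).1 hz).2.2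
    have hδ : 0 < min (R' - R) (Real.pi / 2) :=
      lt_min (by linarith) (by linarith [Real.pi_pos])
    filter_upwards [eventually_half_le hz0,
      (tendsto_rdist_geoMapInv hK hx₀ he hz0).eventually (gt_mem_nhds hδ)] with w hw1 hw2
    have hw0 : 0 < 1 + K * ‖w‖ ^ 2 := by linarith
    have hws := geoMapInv_mem_space hK hx₀ he hw0
    have h1 := hw2.trans_le (min_le_left _ _)
    have h2 := hw2.trans_le (min_le_right _ _)
    have h3 := rdist_triangle hK hzR'.1 hx₀ hws fun h => by
      rw [rdist_comm K _ x₀]; linarith [hRK h]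
    rw [rdist_comm K _ x₀] at h3
    exact (hgrad w hw0 ⟨hws, by linarith⟩).differentiableAt
  refine opNorm_le_of_symmetric hC0 (inner_fderiv_gradient_comm hev hdiff) ?_
  have hρ : 0 < K * ((cosK K R)⁻¹ ^ 2 - 1) := by
    rcases hK with rfl | rfl
    · have h1 := cosK_pos_of_lt (Or.inl rfl) hR hRK
      rw [cosK_one] at h1 ⊢
      have h2 : Real.cos R < 1 := by
        have := Real.cos_lt_cos_of_nonneg_of_le_pi_div_two le_rfl (hRK rfl).le hR
        simpa using this
      have := (one_lt_inv₀ h1).2 h2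
      nlinarith
    · rw [cosK_neg_one]
      have h1 := inv_lt_one_of_one_lt₀ (Real.one_lt_cosh.2 hR.ne')
      have h2 := inv_pos.2 (Real.cosh_pos R)
      nlinarith
  have hiff := fun w => mem_image_geoMap_iff_norm_sq_le (z := w) hK hx₀ he hR hRK
  refine abs_inner_fderiv_le hρ ((hiff z).1 hz) hdiff.hasFDerivAt fun w hw => ?_
  have hw' := (hiff w).2 hw
  -- In the sum of the two inequalities the values of f cancel, leaving the increment of the
  -- gradient along w - z with constant C.
  have h1 := abs_le.1 (hsmooth z hz w hw')
  have h2 := abs_le.1 (hsmooth w hw' z hz)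
  rw [norm_sub_rev z w, ← neg_sub w z, inner_neg_right] at h2
  rw [inner_sub_left, abs_le]
  constructor <;> linarith [h1.1, h1.2, h2.1, h2.2]
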